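/- Let $n\ge 1$ and write points of $\mathbb{R}^n=\mathbb{R}^{n-1}\times\mathbb{R}$ as $(\xi,\tau)$. Put $g(\xi,\tau)=|\xi|^2-\tau^2$ and, for $s\in\mathbb{R}$, let $\sigma_s$ be the canonical (Euclidean) surface measure on the hypersurface $g^{-1}(s)\subset\mathbb{R}^n$, where for $s=0$ the origin is deleted. Let $\eta:\mathbb{R}^n\to\mathbb{R}$ be a smooth radial function supported in the annulus $\{z\in\mathbb{R}^n: 1/4\le|z|\le 5/4\}$, let $\sigma_s^{(0)}=\eta\,\sigma_s$, and let $$\check\sigma_s^{(0)}(x,t)=\int_{g^{-1}(s)}e^{2\pi i(\xi\cdot x+\tau t)}\,\eta(\xi,\tau)\,d\sigma_s(\xi,\tau),\qquad (x,t)\in\mathbb{R}^{n-1}\times\mathbb{R}.$$ Then, for every $s\in(-1/10,1/10)$, $\eta$ is integrable with respect to $\sigma_s$ (so that $\check\sigma_s^{(0)}$ is well defined), and there is a constant $C>0$, depending only on $n$ and $\eta$, such that $$|\check\sigma_s^{(0)}(x,t)|\le C\,(1+|t|)^{\frac{2-n}{2}}$$ for all $s\in(-1/10,1/10)$, all $x\in\mathbb{R}^{n-1}$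 and all $t\in\mathbb{R}$. -/

import Mathlib

open MeasureTheory

noncomputable section

/-- Space-time `ℝ^d × ℝ` (`d` spatial variables and one time variable, total dimension `n = d + 1`),
with the Euclidean norm `‖(ξ, τ)‖² = ‖ξ‖² + τ²`. -/
abbrev SpaceTime (d : ℕ) : Type := WithLp 2 (EuclideanSpace ℝ (Fin d) × ℝ)

/-- The quadratic form `g(ξ, τ) = |ξ|² - τ²`. -/
def waveForm {d : ℕ} (z : SpaceTime d) : ℝ := ‖z.fst‖ ^ 2 - z.snd ^ 2

/-- The embedded hypersurface `g⁻¹(s)`; the origin (which lies on it only for `s = 0`)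
is deleted. -/
def levelSurface (d : ℕ) (s : ℝ) : Set (SpaceTime d) := {z | waveForm z = s ∧ z ≠ 0}

/-- The surface measure `σ_s`: the `d`-dimensional Hausdorff measure, normalized to agree with
`d`-dimensional Lebesgue measure on `d`-dimensional subspaces, restricted to the hypersurface
`g⁻¹(s)`. -/
def surfaceMeasure (d : ℕ) (s : ℝ) : Measure (SpaceTime d) :=
  (Measure.euclideanHausdorffMeasure d).restrict (levelSurface d s)

/-- The inverse Fourier transform of the localized measure `η σ_s` at `(x, t)`, that is
`∫ e^{2πi(ξ·x + τt)} η(ξ, τ) dσ_s(ξ, τ)`. -/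
def invFourierLocalized {d : ℕ} (η : SpaceTime d → ℝ) (s : ℝ)
    (x : EuclideanSpace ℝ (Fin d)) (t : ℝ) : ℂ :=
  ∫ z : SpaceTime d,
    Complex.exp (2 * Real.pi * Complex.I * ((inner ℝ z.fst x + z.snd * t : ℝ) : ℂ)) * (η z : ℂ)
    ∂(surfaceMeasure d s)

/-- `η` is an admissible localization: smooth, radial in all `d + 1` variables, and supported in
the annulus `1/4 ≤ |z| ≤ 5/4`. -/
structure IsAnnularBump {d : ℕ} (η : SpaceTime d → ℝ) : Prop where
  smooth : ContDiff ℝ (⊤ : ℕ∞) η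
  radial : ∀ z w : SpaceTime d, ‖z‖ = ‖w‖ → η z = η w
  support_subset : Function.support η ⊆ {z | 1 / 4 ≤ ‖z‖ ∧ ‖z‖ ≤ 5 / 4}

end

/-!
# Decay of the Fourier transform of surface measure on the hyperboloids `|ξ|² - τ² = s`

Write `n = d + 1`, `y = (x, t)`, `g = waveForm` and `S` for the time reflection, so that
`g z = ⟪S z, z⟫`. Since `|∇g(z)| = 2‖z‖`, the surface measure is formally `2‖z‖ δ(g - s)`.
Therefore the Fourier transform in `s` of the inverse Fourier transform of `η σ_s` at `y` is the
oscillatory integral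
`K(l, y) = ∫ exp (2πi (⟪z, y⟫ - l ⟪S z, z⟫)) · 2‖z‖ η(z) dz`,
in which the geometry of the level sets, and in particular the vertex of the cone, no longer
appears: the amplitude is a Schwartz function supported in the annulus, and the phase is a
nondegenerate quadratic form. The estimate is read off from
`|K(l, y)| ≤ C (1 + ‖y‖)^(-n/2) (1 + (l / (1 + ‖y‖))²)⁻¹`
(`exists_norm_quadOscInt_timeReflection_le`) by Fourier inversion in `s`, because the right-hand
side has `l`-integral `C π (1 + ‖y‖)^(1 - n/2)`, which for `n ≥ 2` is at most
`C π (1 + |t|)^((2 - n)/2)`.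

The bound on `K` combines two facts. For `|l| ≤ √(1 + ‖y‖)`, repeated integration by parts
suffices, since it gives decay in `(1 + ‖y‖) / (1 + |l|)` to any order
(`exists_pow_mul_norm_quadOscInt_le`). For larger `l`, the Fourier transform of the imaginary Gaussian (`norm_quadOscInt_timeReflection_eq`) turns `K` into
`|2l|^(-n/2)` times an integral against the inverse Fourier transform of the amplitude, with a
phase that varies slowly. This gives the dispersive bound `|l|^(-n/2)`. If moreover the critical point
`(2l)⁻¹ S y` is off the annulus, then all terms in the Taylor expansion of that slow phase vanish,
being derivatives of the amplitude at the critical point, and any power of `|l|⁻¹` is gained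
(`exists_norm_integral_fourierInv_mul_quad_le`). The critical point lies in the annulus only for
`|l|` comparable with `‖y‖`.

The formula `σ_s = 2‖z‖ δ(g - s)` is made precise by an area formula for graphs
(`restrict_graph_eq_map`), obtained by comparing Hausdorff measure on a graph with that on its
tangent planes. It writes the surface integral as an integral over `ξ` with density `‖z‖ / τ` on
the two sheets `τ = ±√(|ξ|² - s)` (`integral_surfaceMeasure`); Fubini and the substitution
`s = |ξ|² - τ²` then give `K` (`fourier_sheetIntegral`). Fourier inversion at every single `s` needs
continuity of the surface integral in `s` (`sheetIntegral_regular`), which is not obvious where the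
density `1 / τ` is singular. For `s < 1/20` the set `τ = 0` stays away from the annulus; for `s > 0`
the dilation `ξ = √s ζ` makes the singular factor independent of `s`.

In space-time of dimension `n = 1` the surface is a set of at most two points, and the claim is
trivial since the exponent `(2 - n)/2` is positive.
-/

noncomputable section

/-! ### The area formula for graphs -/

open Measure Filter Topology Set in
theorem euclideanHausdorffMeasure_image_le_of_edist_le {X Y Z : Type*}
    [EMetricSpace Y] [MeasurableSpace Y] [BorelSpace Y]
    [EMetricSpace Z] [MeasurableSpace Z] [BorelSpace Z]
    (d : ℕ) {f : X → Y} {g : X → Z} {A : Set X} {K : NNReal}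
    (h : ∀ x ∈ A, ∀ y ∈ A, edist (f x) (f y) ≤ K * edist (g x) (g y)) :
    μHE[d] (f '' A) ≤ (K : ENNReal) ^ d * μHE[d] (g '' A) := by
  classical
  rcases A.eq_empty_or_nonempty with rfl | ⟨x₀, hx₀⟩
  · simp
  have : Nonempty X := ⟨x₀⟩
  have hinv : ∀ z ∈ g '' A, Function.invFunOn g A z ∈ A ∧ g (Function.invFunOn g A z) = z :=
    fun z hz => ⟨Function.invFunOn_mem hz, Function.invFunOn_eq hz⟩
  have hlip : LipschitzOnWith K (fun z => f (Function.invFunOn g A z)) (g '' A) := by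
    intro z hz w hw
    have := h _ (hinv z hz).1 _ (hinv w hw).1
    rwa [(hinv z hz).2, (hinv w hw).2] at this
  have himg : f '' A ⊆ (fun z => f (Function.invFunOn g A z)) '' (g '' A) := by
    rintro _ ⟨x, hx, rfl⟩
    refine ⟨g x, ⟨x, hx, rfl⟩, ?_⟩
    have h1 := hinv (g x) ⟨x, hx, rfl⟩
    have := h _ h1.1 _ hx
    rw [h1.2, edist_self, mul_zero, nonpos_iff_eq_zero, edist_eq_zero] at this
    exact this
  have hle := (measure_mono himg).trans (hlip.hausdorffMeasure_image_le (d := d) (by positivity))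
  simp only [euclideanHausdorffMeasure_def, Measure.smul_apply, ENNReal.smul_def, smul_eq_mul]
  rw [ENNReal.rpow_natCast] at hle
  calc _ ≤ _ := mul_le_mul_right hle _
    _ = _ := by ring

/-- The graph map `ξ ↦ (ξ, φ ξ)`. -/
def graphMap {d : ℕ} (φ : EuclideanSpace ℝ (Fin d) → ℝ) (ξ : EuclideanSpace ℝ (Fin d)) :
    SpaceTime d := WithLp.toLp 2 (ξ, φ ξ)

/-- The linear graph map `v ↦ (v, ⟪w, v⟫)`, the derivative of the graph map of a function with
gradient `w`. -/
def linearGraphMap {d : ℕ} (w : EuclideanSpace ℝ (Fin d)) :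
    EuclideanSpace ℝ (Fin d) →ₗ[ℝ] SpaceTime d where
  toFun v := WithLp.toLp 2 (v, inner ℝ w v)
  map_add' x y := by rw [inner_add_right]; rfl
  map_smul' c x := by rw [inner_smul_right]; rfl

theorem normDet_linearGraphMap {d : ℕ} (w : EuclideanSpace ℝ (Fin d)) :
    (linearGraphMap w).normDet = √(1 + ‖w‖ ^ 2) := by
  have h : LinearMap.adjoint (linearGraphMap w) ∘ₗ linearGraphMap w =
      LinearMap.transvection (innerₗ _ w) w := by
    ext1 v
    refine ext_inner_right ℝ fun u => ?_
    rw [LinearMap.comp_apply, LinearMap.adjoint_inner_left, WithLp.prod_inner_apply]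
    simp [linearGraphMap, LinearMap.transvection, inner_add_left, inner_smul_left, mul_comm]
  have h2 := LinearMap.normDet_sq (linearGraphMap w)
  rw [h, LinearMap.transvection.det] at h2
  rw [← Real.sqrt_sq (LinearMap.normDet_nonneg (linearGraphMap w))]
  congr 1
  simpa using h2

theorem euclideanHausdorffMeasure_linearGraphMap_image {d : ℕ} (w : EuclideanSpace ℝ (Fin d))
    (A : Set (EuclideanSpace ℝ (Fin d))) :
    μHE[d] (linearGraphMap w '' A) = ENNReal.ofReal √(1 + ‖w‖ ^ 2) * volume A := by
  have := (linearGraphMap w).euclideanHausdorffMeasure_image_eq_normDet_mul_volume A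
  rwa [finrank_euclideanSpace_fin, normDet_linearGraphMap] at this

/-- The graph of a function that is strictly differentiable at `a` is, near `a`, bi-Lipschitz to
the graph of its derivative, with constants as close to `1` as one wishes. -/
theorem eventually_dist_graphMap_le {d : ℕ} {φ : EuclideanSpace ℝ (Fin d) → ℝ}
    {w a : EuclideanSpace ℝ (Fin d)} (h : HasStrictFDerivAt φ (innerSL ℝ w) a) {c : NNReal}
    (hc : 1 < c) : ∃ N ∈ nhds a, ∀ x ∈ N, ∀ y ∈ N,
      dist (graphMap φ x) (graphMap φ y) ≤ c * dist (linearGraphMap w x) (linearGraphMap w y) ∧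
      dist (linearGraphMap w x) (linearGraphMap w y) ≤ c * dist (graphMap φ x) (graphMap φ y) := by
  have hc' : (1 : ℝ) < c := by exact_mod_cast hc
  have hcpos : 0 < 1 - (c : ℝ)⁻¹ := by
    have := inv_lt_one_of_one_lt₀ hc'
    linarith
  obtain ⟨N, hN, happ⟩ := h.approximates_deriv_on_nhds (c := ⟨1 - (c : ℝ)⁻¹, hcpos.le⟩)
    (Or.inr (by exact_mod_cast hcpos))
  refine ⟨N, hN, fun x hx y hy => ?_⟩
  set ε : ℝ := 1 - (c : ℝ)⁻¹ with hε
  have h1 : |φ x - φ y - inner ℝ w (x - y)| ≤ ε * ‖x - y‖ := by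
    have := happ x hx y hy
    rw [innerSL_apply_apply, Real.norm_eq_abs] at this
    exact this
  -- `P` and `Q` are the increments of the two graph maps; they share their first component.
  set P := graphMap φ x - graphMap φ y with hP
  set Q := linearGraphMap w x - linearGraphMap w y with hQ
  have hQ' : Q = linearGraphMap w (x - y) := by rw [hQ, map_sub]
  have hfst : ‖x - y‖ ≤ ‖P‖ := WithLp.norm_fst_le _ P
  have hfst' : ‖x - y‖ ≤ ‖Q‖ := by rw [hQ']; exact WithLp.norm_fst_le _ (linearGraphMap w (x - y))
  have hdiff : ‖P - Q‖ ≤ ε * ‖x - y‖ := by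
    have : P - Q = WithLp.toLp 2 ((0 : EuclideanSpace ℝ (Fin d)),
        φ x - φ y - inner ℝ w (x - y)) := by
      rw [hQ', hP]
      apply (WithLp.ofLp_injective 2)
      ext1 <;> simp [graphMap, linearGraphMap]
    rw [this]
    refine le_trans (le_of_eq ?_) h1
    rw [← sq_eq_sq₀ (norm_nonneg _) (abs_nonneg _), WithLp.prod_norm_sq_eq_of_L2]
    simp
  rw [dist_eq_norm, dist_eq_norm]
  have hcε : (c : ℝ) * (1 - ε) = 1 := by
    rw [hε]; field_simp; ring
  have hε1 : 1 + ε ≤ c := by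
    nlinarith
  have hεpos : 0 < ε := hcpos
  have t1 : ‖P‖ ≤ ‖Q‖ + ‖P - Q‖ := by
    have := norm_add_le Q (P - Q); simpa using this
  have t2 : ‖Q‖ ≤ ‖P‖ + ‖P - Q‖ := by
    have := norm_sub_le P (P - Q); simpa using this
  constructor
  · nlinarith [norm_nonneg Q]
  · have h3 : (1 - ε) * ‖Q‖ ≤ ‖P‖ := by nlinarith
    have : (c : ℝ) * ((1 - ε) * ‖Q‖) ≤ c * ‖P‖ := by gcongr
    rw [← mul_assoc, hcε, one_mul] at this
    exact this

open Set in
/-- A comparison of two measures that holds near each point of a set holds on the whole set. -/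
theorem measure_le_of_locally_le {X : Type*} [TopologicalSpace X] [SecondCountableTopology X]
    [MeasurableSpace X] [OpensMeasurableSpace X] {μ ν : Measure X} {U : Set X}
    (h : ∀ x ∈ U, ∃ N ∈ nhds x, ∀ A ⊆ N ∩ U, MeasurableSet A → μ A ≤ ν A)
    {A : Set X} (hA : MeasurableSet A) (hAU : A ⊆ U) : μ A ≤ ν A := by
  choose! N hN hle using h
  obtain ⟨t, htU, htc, hcov⟩ := TopologicalSpace.countable_cover_nhdsWithin
    (f := fun x => interior (N x)) (s := U)
    fun x hx => mem_nhdsWithin_of_mem_nhds (interior_mem_nhds.2 (hN x hx))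
  rcases t.eq_empty_or_nonempty with rfl | hne
  · have : A = ∅ := by
      have := hAU.trans hcov
      simpa using this
    simp [this]
  obtain ⟨u, rfl⟩ := htc.exists_eq_range hne
  have hmeas : ∀ n, MeasurableSet (disjointed (fun n => interior (N (u n))) n) :=
    fun n => MeasurableSet.disjointed (fun n => isOpen_interior.measurableSet) n
  have hA_eq : A = ⋃ n, A ∩ disjointed (fun n => interior (N (u n))) n := by
    rw [← inter_iUnion, iUnion_disjointed, eq_comm, inter_eq_left]
    refine (hAU.trans hcov).trans ?_
    simp
  have hdisj : Pairwise (Function.onFun Disjoint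
      fun n => A ∩ disjointed (fun n => interior (N (u n))) n) :=
    fun i j hij => (disjoint_disjointed _ hij).mono inter_subset_right inter_subset_right
  rw [hA_eq, measure_iUnion hdisj fun n => hA.inter (hmeas n),
    measure_iUnion hdisj fun n => hA.inter (hmeas n)]
  refine ENNReal.tsum_le_tsum fun n => ?_
  refine hle (u n) (htU (mem_range_self n)) _ ?_ (hA.inter (hmeas n))
  exact fun x hx => ⟨interior_subset (disjointed_subset (fun n => interior (N (u n))) n hx.2), hAU hx.1⟩

theorem graphMap_fst {d : ℕ} (φ : EuclideanSpace ℝ (Fin d) → ℝ) (ξ : EuclideanSpace ℝ (Fin d)) :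
    (graphMap φ ξ).fst = ξ := rfl

theorem graphMap_snd {d : ℕ} (φ : EuclideanSpace ℝ (Fin d) → ℝ) (ξ : EuclideanSpace ℝ (Fin d)) :
    (graphMap φ ξ).snd = φ ξ := rfl

theorem measurable_graphMap {d : ℕ} {φ : EuclideanSpace ℝ (Fin d) → ℝ} (hφ : Measurable φ) :
    Measurable (graphMap φ) :=
  (WithLp.measurable_toLp 2 _).comp (measurable_id.prodMk hφ)

theorem measurable_fst_spaceTime {d : ℕ} :
    Measurable fun z : SpaceTime d => z.fst :=
  measurable_fst.comp (WithLp.measurable_ofLp 2 _)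

open Set in
/-- Area formula for graphs, in the form of an identity of measures on the graph. -/
theorem restrict_graph_eq_map {d : ℕ} {φ : EuclideanSpace ℝ (Fin d) → ℝ}
    {w : EuclideanSpace ℝ (Fin d) → EuclideanSpace ℝ (Fin d)} {U : Set (EuclideanSpace ℝ (Fin d))}
    (hU : IsOpen U) (hφ : Measurable φ) (hw : Measurable w) (hwU : ContinuousOn w U)
    (hder : ∀ x ∈ U, HasStrictFDerivAt φ (innerSL ℝ (w x)) x) :
    (μHE[d] : Measure (SpaceTime d)).restrict (graphMap φ '' U) =
      ((volume.restrict U).withDensity fun x => ENNReal.ofReal √(1 + ‖w x‖ ^ 2)).map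
        (graphMap φ) := by
  set J : EuclideanSpace ℝ (Fin d) → ENNReal := fun x => ENNReal.ofReal √(1 + ‖w x‖ ^ 2) with hJ
  have hJm : Measurable J := by fun_prop
  have hgU : MeasurableSet (graphMap φ '' U) := by
    have : graphMap φ '' U = {z : SpaceTime d | z.fst ∈ U ∧ graphMap φ z.fst = z} := by
      ext z
      constructor
      · rintro ⟨x, hx, rfl⟩; exact ⟨hx, rfl⟩
      · rintro ⟨h1, h2⟩; exact ⟨_, h1, h2⟩
    rw [this]
    exact (measurable_fst_spaceTime hU.measurableSet).inter
      (measurableSet_eq_fun ((measurable_graphMap hφ).comp measurable_fst_spaceTime) measurable_id)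
  -- The Hausdorff measure of the graph over `A`, as a measure in `A`.
  set κ : Measure (EuclideanSpace ℝ (Fin d)) :=
    ((μHE[d] : Measure (SpaceTime d)).restrict (graphMap φ '' U)).map (fun z => z.fst) with hκ
  set ν := (volume.restrict U).withDensity J with hν
  have hκA : ∀ A ⊆ U, MeasurableSet A → κ A = μHE[d] (graphMap φ '' A) := by
    intro A hAU hA
    rw [hκ, Measure.map_apply measurable_fst_spaceTime hA,
      Measure.restrict_apply (measurable_fst_spaceTime hA)]
    congr 1
    ext z
    constructor
    · rintro ⟨h1, x, hx, rfl⟩; exact ⟨x, h1, rfl⟩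
    · rintro ⟨x, hx, rfl⟩; exact ⟨hx, x, hAU hx, rfl⟩
  have hνA : ∀ A ⊆ U, MeasurableSet A → ν A = ∫⁻ x in A, J x := by
    intro A hAU hA
    rw [hν, withDensity_apply _ hA, Measure.restrict_restrict hA, inter_eq_left.2 hAU]
  -- Near each point the graph is `c`-bi-Lipschitz to a tangent plane and the density varies by a
  -- factor at most `c`; letting `c → 1` gives equality.
  have key : ∀ c : NNReal, 1 < c → ∀ A ⊆ U, MeasurableSet A →
      κ A ≤ (c : ENNReal) ^ (d + 1) * ν A ∧ ν A ≤ (c : ENNReal) ^ (d + 1) * κ A := by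
    intro c hc
    have hloc : ∀ x ∈ U, ∃ N ∈ nhds x, ∀ A ⊆ N ∩ U, MeasurableSet A →
        κ A ≤ (c : ENNReal) ^ (d + 1) * ν A ∧ ν A ≤ (c : ENNReal) ^ (d + 1) * κ A := by
      intro x hx
      obtain ⟨N, hN, hdist⟩ := eventually_dist_graphMap_le (hder x hx) hc
      have hcont : ContinuousAt (fun y => √(1 + ‖w y‖ ^ 2)) x := by
        have := (hwU x hx).continuousAt (hU.mem_nhds hx)
        fun_prop
      have hJpos : 0 < √(1 + ‖w x‖ ^ 2) := by positivity
      have hc' : (1 : ℝ) < c := by exact_mod_cast hc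
      have e1 : ∀ᶠ y in nhds x, √(1 + ‖w y‖ ^ 2) < c * √(1 + ‖w x‖ ^ 2) :=
        hcont.eventually_lt continuousAt_const (by nlinarith)
      have e2 : ∀ᶠ y in nhds x, √(1 + ‖w x‖ ^ 2) < c * √(1 + ‖w y‖ ^ 2) :=
        continuousAt_const.eventually_lt (continuousAt_const.mul hcont) (by nlinarith)
      refine ⟨N ∩ {y | √(1 + ‖w y‖ ^ 2) < c * √(1 + ‖w x‖ ^ 2) ∧
        √(1 + ‖w x‖ ^ 2) < c * √(1 + ‖w y‖ ^ 2)}, Filter.inter_mem hN (e1.and e2), ?_⟩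
      intro A hA hAm
      have hAU : A ⊆ U := fun y hy => (hA hy).2
      rw [hκA A hAU hAm, hνA A hAU hAm]
      have hlin := euclideanHausdorffMeasure_linearGraphMap_image (w x) A
      have b1 : μHE[d] (graphMap φ '' A) ≤ (c : ENNReal) ^ d * μHE[d] (linearGraphMap (w x) '' A) :=
        euclideanHausdorffMeasure_image_le_of_edist_le d fun y hy z hz => by
          have := (hdist y (hA hy).1.1 z (hA hz).1.1).1
          rw [edist_nndist, edist_nndist]
          exact_mod_cast this
      have b2 : μHE[d] (linearGraphMap (w x) '' A) ≤ (c : ENNReal) ^ d * μHE[d] (graphMap φ '' A) :=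
        euclideanHausdorffMeasure_image_le_of_edist_le d fun y hy z hz => by
          have := (hdist y (hA hy).1.1 z (hA hz).1.1).2
          rw [edist_nndist, edist_nndist]
          exact_mod_cast this
      rw [hlin] at b1 b2
      have hcJ : ∀ r : ℝ, ENNReal.ofReal (c * r) = c * ENNReal.ofReal r := fun r => by
        rw [ENNReal.ofReal_mul (by positivity)]; simp
      have b3 : J x * volume A ≤ c * ∫⁻ y in A, J y := by
        rw [← lintegral_const_mul _ hJm, ← setLIntegral_const]
        refine setLIntegral_mono (by fun_prop) fun y hy => ?_
        simp only [hJ]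
        rw [← hcJ]
        exact ENNReal.ofReal_le_ofReal (hA hy).1.2.2.le
      have b4 : ∫⁻ y in A, J y ≤ c * (J x * volume A) := by
        rw [← mul_assoc, ← setLIntegral_const]
        refine setLIntegral_mono (by fun_prop) fun y hy => ?_
        simp only [hJ]
        rw [← hcJ]
        exact ENNReal.ofReal_le_ofReal (hA hy).1.2.1.le
      constructor
      · calc _ ≤ _ := b1
          _ ≤ (c : ENNReal) ^ d * (c * ∫⁻ y in A, J y) := by gcongr
          _ = _ := by ring
      · calc _ ≤ _ := b4
          _ ≤ c * ((c : ENNReal) ^ d * μHE[d] (graphMap φ '' A)) := by gcongr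
          _ = _ := by ring
    intro A hAU hA
    constructor
    · refine measure_le_of_locally_le (μ := κ) (ν := (c : ENNReal) ^ (d + 1) • ν) ?_ hA hAU
      intro x hx
      obtain ⟨N, hN, h⟩ := hloc x hx
      exact ⟨N, hN, fun A hA hAm => (h A hA hAm).1⟩
    · refine measure_le_of_locally_le (μ := ν) (ν := (c : ENNReal) ^ (d + 1) • κ) ?_ hA hAU
      intro x hx
      obtain ⟨N, hN, h⟩ := hloc x hx
      exact ⟨N, hN, fun A hA hAm => (h A hA hAm).2⟩
  have hlim : ∀ a b : ENNReal, (∀ c : NNReal, 1 < c → a ≤ (c : ENNReal) ^ (d + 1) * b) →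
      a ≤ b := by
    intro a b h
    have ht : Filter.Tendsto (fun c : NNReal => (c : ENNReal) ^ (d + 1) * b)
        (nhdsWithin 1 (Ioi 1)) (nhds (((1 : NNReal) : ENNReal) ^ (d + 1) * b)) := by
      refine Filter.Tendsto.mono_left ?_ nhdsWithin_le_nhds
      refine ENNReal.Tendsto.mul_const ?_ (Or.inl (by simp))
      exact ((ENNReal.continuous_pow (d + 1)).comp ENNReal.continuous_coe).tendsto 1
    rw [ENNReal.coe_one, one_pow, one_mul] at ht
    refine ge_of_tendsto ht ?_
    filter_upwards [self_mem_nhdsWithin] with c hc using h c hc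
  ext B hB
  rw [Measure.map_apply (measurable_graphMap hφ) hB, Measure.restrict_apply hB]
  set A := graphMap φ ⁻¹' B ∩ U with hAdef
  have hA : MeasurableSet A := (measurable_graphMap hφ hB).inter hU.measurableSet
  have hAU : A ⊆ U := inter_subset_right
  have h1 : B ∩ graphMap φ '' U = graphMap φ '' A := by
    ext z
    constructor
    · rintro ⟨h1, x, hx, rfl⟩; exact ⟨x, ⟨h1, hx⟩, rfl⟩
    · rintro ⟨x, hx, rfl⟩; exact ⟨hx.1, x, hx.2, rfl⟩
  have h2 : ν (graphMap φ ⁻¹' B) = ν A := by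
    rw [hνA A hAU hA, hν, withDensity_apply _ (measurable_graphMap hφ hB),
      Measure.restrict_restrict (measurable_graphMap hφ hB)]
  rw [h1, h2, ← hκA A hAU hA]
  exact le_antisymm (hlim _ _ fun c hc => (key c hc A hAU hA).1)
    (hlim _ _ fun c hc => (key c hc A hAU hA).2)

/-! ### Oscillatory integrals with quadratic phase -/

open scoped SchwartzMap FourierTransform LineDeriv

section QuadraticPhase

variable {E : Type*} [NormedAddCommGroup E] [InnerProductSpace ℝ E]

/-- The oscillating factor `exp (2πi (⟪z, y⟫ - l ⟪S z, z⟫))`, for a linear map `S` on an inner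
product space. -/
def quadPhase (S : E →ₗ[ℝ] E) (l : ℝ) (y z : E) : ℂ :=
  Complex.exp (((2 * Real.pi * (inner ℝ z y - l * inner ℝ (S z) z) : ℝ) : ℂ) * Complex.I)

theorem norm_quadPhase (S : E →ₗ[ℝ] E) (l : ℝ) (y z : E) : ‖quadPhase S l y z‖ = 1 :=
  Complex.norm_exp_ofReal_mul_I _

theorem hasTemperateGrowth_inner_const (m : E) :
    (fun z : E => (inner ℝ z m : ℝ)).HasTemperateGrowth :=
  ((innerSL ℝ).flip m).hasTemperateGrowth

variable [FiniteDimensional ℝ E]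

theorem continuous_quadPhase (S : E →ₗ[ℝ] E) (l : ℝ) (y : E) : Continuous (quadPhase S l y) := by
  have := S.continuous_of_finiteDimensional
  unfold quadPhase
  fun_prop

theorem hasFDerivAt_quadPhase {S : E →ₗ[ℝ] E} (hS : S.IsSymmetric) (l : ℝ) (y z : E) :
    HasFDerivAt (quadPhase S l y) ((quadPhase S l y z * Complex.I) • (Complex.ofRealCLM.comp
      ((2 * Real.pi) • (innerSL ℝ y - l • (2 : ℝ) • innerSL ℝ (S z))))) z := by
  have h1 : HasFDerivAt (fun z : E => (inner ℝ z y : ℝ)) (innerSL ℝ y) z := by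
    simp_rw [real_inner_comm y]
    exact (innerSL ℝ y).hasFDerivAt
  have h0 : HasFDerivAt (fun z : E => (inner ℝ (S z) z : ℝ)) ((2 : ℝ) • innerSL ℝ (S z)) z := by
    refine ((S.toContinuousLinearMap.hasFDerivAt (x := z)).inner ℝ (hasFDerivAt_id z)).congr_fderiv
      ?_
    ext v
    have : inner ℝ (S v) z = inner ℝ (S z) v := by rw [hS v z, real_inner_comm]
    simp [this]
    ring
  have h2 := ((h1.sub (h0.const_mul l)).const_mul (2 * Real.pi))
  have h3 := ((Complex.ofRealCLM.hasFDerivAt.comp z h2).mul_const Complex.I).cexp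
  refine h3.congr_fderiv ?_
  ext v
  simp [quadPhase]
  ring

/-- The second order differential operator `h ↦ ∑ i, ∂_{e i} ∂_{S (e i)} h` with symbol
`-4π² ⟪S ζ, ζ⟫`, where `e` is an orthonormal basis. -/
def quadDiffOp (S : E →ₗ[ℝ] E) (h : 𝓢(E, ℂ)) : 𝓢(E, ℂ) :=
  ∑ i, ∂_{stdOrthonormalBasis ℝ E i} (∂_{S (stdOrthonormalBasis ℝ E i)} h : 𝓢(E, ℂ))

theorem tsupport_quadDiffOp_subset (S : E →ₗ[ℝ] E) (h : 𝓢(E, ℂ)) :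
    tsupport (quadDiffOp S h) ⊆ tsupport h := by
  refine closure_minimal (fun z hz => ?_) (isClosed_tsupport _)
  by_contra hz'
  refine hz ?_
  rw [quadDiffOp, sum_apply]
  refine Finset.sum_eq_zero fun i _ => image_eq_zero_of_notMem_tsupport fun hmem => hz' ?_
  exact SchwartzMap.tsupport_lineDerivOp_subset _ _
    (SchwartzMap.tsupport_lineDerivOp_subset _ _ hmem)

theorem tsupport_iterate_quadDiffOp_subset (S : E →ₗ[ℝ] E) (h : 𝓢(E, ℂ)) (j : ℕ) :
    tsupport ((quadDiffOp S)^[j] h) ⊆ tsupport h := by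
  induction j with
  | zero => simp
  | succ j ih =>
    rw [Function.iterate_succ_apply']
    exact (tsupport_quadDiffOp_subset S _).trans ih

variable [MeasurableSpace E] [BorelSpace E]

/-- The oscillatory integral `∫ exp (2πi (⟪z, y⟫ - l ⟪S z, z⟫)) h z dz`. -/
def quadOscInt (S : E →ₗ[ℝ] E) (h : E → ℂ) (l : ℝ) (y : E) : ℂ :=
  ∫ z, quadPhase S l y z * h z

theorem integrable_quadPhase_mul {h : E → ℂ} (hh : Integrable h) (S : E →ₗ[ℝ] E) (l : ℝ) (y : E) :
    Integrable fun z => quadPhase S l y z * h z :=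
  hh.bdd_mul (c := 1) (continuous_quadPhase S l y).aestronglyMeasurable
    (Filter.Eventually.of_forall fun z => (norm_quadPhase S l y z).le)

theorem norm_quadOscInt_le (S : E →ₗ[ℝ] E) (h : E → ℂ) (l : ℝ) (y : E) :
    ‖quadOscInt S h l y‖ ≤ ∫ z, ‖h z‖ := by
  refine (norm_integral_le_integral_norm _).trans (le_of_eq ?_)
  simp [norm_quadPhase]

/-- Integration by parts in the direction `m`. -/
theorem inner_mul_quadOscInt {S : E →ₗ[ℝ] E} (hS : S.IsSymmetric) (h : 𝓢(E, ℂ)) (l : ℝ)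
    (y m : E) :
    (2 * Real.pi * inner ℝ y m * Complex.I) * quadOscInt S h l y =
      (4 * Real.pi * l * Complex.I) * quadOscInt S
        (SchwartzMap.smulLeftCLM ℂ (fun z : E => (inner ℝ z (S m) : ℝ)) h) l y -
        quadOscInt S (∂_{m} h : 𝓢(E, ℂ)) l y := by
  set q := SchwartzMap.smulLeftCLM ℂ (fun z : E => (inner ℝ z (S m) : ℝ)) h with hq
  have hqz : ∀ z, q z = (inner ℝ (S z) m : ℝ) * h z := fun z => by
    rw [hS z m]
    exact SchwartzMap.smulLeftCLM_apply_apply (hasTemperateGrowth_inner_const _) h z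
  have hder : ∀ z, fderiv ℝ (quadPhase S l y) z m * h z =
      (2 * Real.pi * inner ℝ y m * Complex.I) * (quadPhase S l y z * h z) -
      (4 * Real.pi * l * Complex.I) * (quadPhase S l y z * q z) := fun z => by
    rw [(hasFDerivAt_quadPhase hS l y z).fderiv, hqz]
    simp
    ring
  have i1 := (integrable_quadPhase_mul h.integrable S l y).const_mul
    (2 * Real.pi * inner ℝ y m * Complex.I)
  have i2 := (integrable_quadPhase_mul q.integrable S l y).const_mul (4 * Real.pi * l * Complex.I)
  have hparts := integral_mul_fderiv_eq_neg_fderiv_mul_of_integrable (μ := volume) (v := m)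
    (f := quadPhase S l y) (g := h)
    (by simp_rw [hder]; exact i1.sub i2)
    (integrable_quadPhase_mul (∂_{m} h : 𝓢(E, ℂ)).integrable S l y)
    (integrable_quadPhase_mul h.integrable S l y)
    (fun z _ => (hasFDerivAt_quadPhase hS l y z).differentiableAt)
    (fun z _ => h.differentiableAt)
  simp_rw [hder] at hparts
  rw [integral_sub i1 i2, integral_const_mul, integral_const_mul] at hparts
  have : quadOscInt S (∂_{m} h : 𝓢(E, ℂ)) l y = ∫ z, quadPhase S l y z * fderiv ℝ h z m := rfl
  rw [this, hparts]
  simp only [quadOscInt]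
  ring

theorem abs_inner_mul_norm_quadOscInt_le {S : E →ₗ[ℝ] E} (hS : S.IsSymmetric) (h : 𝓢(E, ℂ))
    (l : ℝ) (y m : E) :
    |inner ℝ y m| * ‖quadOscInt S h l y‖ ≤ 2 * |l| * ‖quadOscInt S
        (SchwartzMap.smulLeftCLM ℂ (fun z : E => (inner ℝ z (S m) : ℝ)) h) l y‖ +
        ‖quadOscInt S (∂_{m} h : 𝓢(E, ℂ)) l y‖ := by
  have h1 := congrArg norm (inner_mul_quadOscInt hS h l y m)
  have h2 := h1.le.trans (norm_sub_le _ _)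
  have hpi := Real.pi_gt_three
  simp only [norm_mul, Complex.norm_I, mul_one, Complex.norm_real, Complex.norm_ofNat,
    Real.norm_eq_abs, abs_of_pos Real.pi_pos] at h2
  have h3 := norm_nonneg (quadOscInt S (∂_{m} h : 𝓢(E, ℂ)) l y)
  have h4 : 2 * Real.pi * (|inner ℝ y m| * ‖quadOscInt S h l y‖) ≤ 2 * Real.pi * (2 * |l| *
      ‖quadOscInt S (SchwartzMap.smulLeftCLM ℂ (fun z : E => (inner ℝ z (S m) : ℝ)) h) l y‖ +
      ‖quadOscInt S (∂_{m} h : 𝓢(E, ℂ)) l y‖) := by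
    nlinarith
  exact le_of_mul_le_mul_left h4 (by positivity)

/-- Repeated integration by parts: the oscillatory integral decays like any power of
`(1 + |l|) / (1 + ‖y‖)`. -/
theorem exists_pow_mul_norm_quadOscInt_le {S : E →ₗ[ℝ] E} (hS : S.IsSymmetric) (N : ℕ)
    (h : 𝓢(E, ℂ)) :
    ∃ C : ℝ, 0 ≤ C ∧ ∀ (l : ℝ) (y : E),
      (1 + ‖y‖) ^ N * ‖quadOscInt S h l y‖ ≤ C * (1 + |l|) ^ N := by
  induction N generalizing h with
  | zero =>
    refine ⟨∫ z, ‖h z‖, integral_nonneg fun z => norm_nonneg _, fun l y => ?_⟩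
    simpa using norm_quadOscInt_le S h l y
  | succ N ih =>
    let b := stdOrthonormalBasis ℝ E
    obtain ⟨C₀, hC₀, hb₀⟩ := ih h
    choose C₁ hC₁ hb₁ using fun i => ih (SchwartzMap.smulLeftCLM ℂ
      (fun z : E => (inner ℝ z (S (b i)) : ℝ)) h)
    choose C₂ hC₂ hb₂ using fun i => ih (∂_{b i} h)
    refine ⟨C₀ + ∑ i, (2 * C₁ i + C₂ i), add_nonneg hC₀ (Finset.sum_nonneg fun i _ => by
      have := hC₁ i; have := hC₂ i; positivity), fun l y => ?_⟩
    have hy : ‖y‖ ≤ ∑ i, |inner ℝ y (b i)| := by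
      calc ‖y‖ = ‖∑ i, inner ℝ (b i) y • b i‖ := by rw [b.sum_repr']
        _ ≤ ∑ i, ‖inner ℝ (b i) y • b i‖ := norm_sum_le _ _
        _ = _ := by simp [norm_smul, real_inner_comm y]
    have hterm : ∀ i, (1 + ‖y‖) ^ N * (|inner ℝ y (b i)| * ‖quadOscInt S h l y‖) ≤
        (2 * C₁ i + C₂ i) * (1 + |l|) ^ (N + 1) := fun i => by
      have h1 := hb₁ i l y
      have h2 := hb₂ i l y
      have h3 : C₂ i * (1 + |l|) ^ N ≤ C₂ i * (1 + |l|) ^ (N + 1) := by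
        have := hC₂ i
        gcongr
        · linarith [abs_nonneg l]
        · omega
      have h4 : |l| * (C₁ i * (1 + |l|) ^ N) ≤ C₁ i * (1 + |l|) ^ (N + 1) := by
        have := mul_nonneg (hC₁ i) (pow_nonneg (by positivity : 0 ≤ 1 + |l|) N)
        rw [pow_succ]
        nlinarith
      calc _ ≤ (1 + ‖y‖) ^ N * (2 * |l| * ‖quadOscInt S (SchwartzMap.smulLeftCLM ℂ
            (fun z : E => (inner ℝ z (S (b i)) : ℝ)) h) l y‖ +
            ‖quadOscInt S (∂_{b i} h : 𝓢(E, ℂ)) l y‖) := by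
              gcongr; exact abs_inner_mul_norm_quadOscInt_le hS h l y (b i)
        _ = 2 * (|l| * ((1 + ‖y‖) ^ N * ‖quadOscInt S (SchwartzMap.smulLeftCLM ℂ
            (fun z : E => (inner ℝ z (S (b i)) : ℝ)) h) l y‖)) +
            (1 + ‖y‖) ^ N * ‖quadOscInt S (∂_{b i} h : 𝓢(E, ℂ)) l y‖ := by ring
        _ ≤ 2 * (|l| * (C₁ i * (1 + |l|) ^ N)) + C₂ i * (1 + |l|) ^ N := by gcongr
        _ ≤ _ := by linarith
    have h0 : C₀ * (1 + |l|) ^ N ≤ C₀ * (1 + |l|) ^ (N + 1) := by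
      gcongr
      · linarith [abs_nonneg l]
      · omega
    calc (1 + ‖y‖) ^ (N + 1) * ‖quadOscInt S h l y‖
        ≤ (1 + ‖y‖) ^ N * (1 + ∑ i, |inner ℝ y (b i)|) * ‖quadOscInt S h l y‖ := by
          rw [pow_succ]; gcongr
      _ = (1 + ‖y‖) ^ N * ‖quadOscInt S h l y‖ +
          ∑ i, (1 + ‖y‖) ^ N * (|inner ℝ y (b i)| * ‖quadOscInt S h l y‖) := by
          rw [← Finset.mul_sum, ← Finset.sum_mul]; ring
      _ ≤ C₀ * (1 + |l|) ^ N + ∑ i, (2 * C₁ i + C₂ i) * (1 + |l|) ^ (N + 1) :=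
          add_le_add (hb₀ l y) (Finset.sum_le_sum fun i _ => hterm i)
      _ ≤ (C₀ + ∑ i, (2 * C₁ i + C₂ i)) * (1 + |l|) ^ (N + 1) := by
          rw [← Finset.sum_mul, add_mul]; gcongr

theorem fourierInv_lineDerivOp_apply (h : 𝓢(E, ℂ)) (m ζ : E) :
    𝓕⁻ (∂_{m} h : 𝓢(E, ℂ)) ζ = -(2 * Real.pi * Complex.I) * inner ℝ ζ m * 𝓕⁻ h ζ := by
  rw [SchwartzMap.fourierInv_lineDerivOp_eq, smul_apply,
    SchwartzMap.smulLeftCLM_apply_apply (hasTemperateGrowth_inner_const m)]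
  simp
  ring

theorem fourierInv_quadDiffOp {S : E →ₗ[ℝ] E} (hS : S.IsSymmetric) (h : 𝓢(E, ℂ)) (ζ : E) :
    𝓕⁻ (quadDiffOp S h) ζ = -(4 * Real.pi ^ 2) * (inner ℝ (S ζ) ζ : ℝ) * 𝓕⁻ h ζ := by
  have h1 := (stdOrthonormalBasis ℝ E).sum_inner_mul_inner (S ζ) ζ
  have h2 : 𝓕⁻ (quadDiffOp S h) =
      ∑ i, 𝓕⁻ (∂_{stdOrthonormalBasis ℝ E i} (∂_{S (stdOrthonormalBasis ℝ E i)} h : 𝓢(E, ℂ)) :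
        𝓢(E, ℂ)) :=
    map_sum (FourierTransform.fourierInvCLM ℂ 𝓢(E, ℂ)) _ _
  rw [h2, sum_apply, ← h1]
  simp_rw [fourierInv_lineDerivOp_apply]
  push_cast
  rw [Finset.mul_sum, Finset.sum_mul]
  refine Finset.sum_congr rfl fun i _ => ?_
  rw [hS ζ, real_inner_comm ζ (stdOrthonormalBasis ℝ E i)]
  ring_nf
  rw [Complex.I_sq]
  ring

theorem fourierInv_iterate_quadDiffOp {S : E →ₗ[ℝ] E} (hS : S.IsSymmetric) (h : 𝓢(E, ℂ)) (j : ℕ)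
    (ζ : E) : 𝓕⁻ ((quadDiffOp S)^[j] h) ζ =
      (-(4 * Real.pi ^ 2) * (inner ℝ (S ζ) ζ : ℝ)) ^ j * 𝓕⁻ h ζ := by
  induction j with
  | zero => simp
  | succ j ih => rw [Function.iterate_succ_apply', fourierInv_quadDiffOp hS, ih]; ring

/-- The Taylor remainder of order `M` of `exp (i u)`, for all real `u` and not only for small ones. -/
theorem exists_norm_exp_mul_I_sub_sum_le (M : ℕ) : ∃ C : ℝ, 0 ≤ C ∧ ∀ u : ℝ,
    ‖Complex.exp (u * Complex.I) - ∑ j ∈ Finset.range M, (u * Complex.I) ^ j / (j.factorial : ℂ)‖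
      ≤ C * |u| ^ M := by
  rcases M.eq_zero_or_pos with rfl | hM
  · exact ⟨1, zero_le_one, fun u => by simp [Complex.norm_exp_ofReal_mul_I]⟩
  refine ⟨max (M.succ * (M.factorial * M : ℝ)⁻¹) (1 + M), by positivity, fun u => ?_⟩
  have hu : ‖(u : ℂ) * Complex.I‖ = |u| := by simp
  rcases le_total |u| 1 with h | h
  · have := Complex.exp_bound (hu.trans_le h) hM
    rw [hu] at this
    refine this.trans ?_
    rw [mul_comm]
    gcongr
    exact le_max_left _ _
  · have h1 : (1 : ℝ) ≤ |u| ^ M := one_le_pow₀ h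
    refine (norm_sub_le _ _).trans ?_
    have h2 : ‖∑ j ∈ Finset.range M, (u * Complex.I) ^ j / (j.factorial : ℂ)‖ ≤
        ∑ j ∈ Finset.range M, |u| ^ M := by
      refine norm_sum_le_of_le _ fun j hj => ?_
      rw [norm_div, norm_pow, hu, Complex.norm_natCast]
      have h3 : |u| ^ j ≤ |u| ^ M := pow_le_pow_right₀ h (Finset.mem_range.1 hj).le
      refine (div_le_self (by positivity) ?_).trans h3
      exact_mod_cast j.factorial_pos
    rw [Complex.norm_exp_ofReal_mul_I]
    rw [Finset.sum_const, Finset.card_range, nsmul_eq_mul] at h2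
    calc _ ≤ |u| ^ M + M * |u| ^ M := add_le_add h1 h2
      _ = (1 + M) * |u| ^ M := by ring
      _ ≤ _ := by gcongr; exact le_max_right _ _

/-- The moments of `𝓕⁻ h` against powers of the quadratic form, with the frequency `w`, are the
values at `w` of iterated derivatives of `h`; they vanish off the support of `h`. -/
theorem integral_quad_pow_mul_fourierInv_eq_zero {S : E →ₗ[ℝ] E} (hS : S.IsSymmetric)
    (h : 𝓢(E, ℂ)) {w : E} (hw : w ∉ tsupport h) (j : ℕ) :
    ∫ ζ, Complex.exp (((-2 * Real.pi * inner ℝ ζ w : ℝ) : ℂ) * Complex.I) *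
      (((inner ℝ (S ζ) ζ : ℝ) : ℂ) ^ j * 𝓕⁻ h ζ) = 0 := by
  have h0 : (quadDiffOp S)^[j] h w = 0 :=
    image_eq_zero_of_notMem_tsupport fun hm => hw (tsupport_iterate_quadDiffOp_subset S h j hm)
  have h1 : 𝓕 (𝓕⁻ ((quadDiffOp S)^[j] h)) w = 0 := by
    rw [FourierTransform.fourier_fourierInv_eq, h0]
  rw [SchwartzMap.fourier_coe, Real.fourier_eq'] at h1
  simp_rw [fourierInv_iterate_quadDiffOp hS, smul_eq_mul] at h1
  have hc : (-(4 * (Real.pi : ℂ) ^ 2)) ^ j ≠ 0 := by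
    refine pow_ne_zero _ (neg_ne_zero.2 ?_)
    have := Real.pi_ne_zero
    exact mul_ne_zero (by norm_num) (pow_ne_zero _ (by exact_mod_cast this))
  refine (mul_eq_zero.1 (?_ : (-(4 * (Real.pi : ℂ) ^ 2)) ^ j * _ = 0)).resolve_left hc
  rw [← integral_const_mul, ← h1]
  refine integral_congr_ae (Filter.Eventually.of_forall fun ζ => ?_)
  simp only [mul_pow]
  ring

theorem integrable_abs_quad_pow_mul_norm_fourierInv {S : E →ₗ[ℝ] E} (hS : S.IsSymmetric)
    (h : 𝓢(E, ℂ)) (j : ℕ) :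
    Integrable fun ζ => |(inner ℝ (S ζ) ζ : ℝ)| ^ j * ‖𝓕⁻ h ζ‖ := by
  have h1 := ((𝓕⁻ ((quadDiffOp S)^[j] h)).integrable (μ := volume)).norm.const_mul
    ((4 * Real.pi ^ 2)⁻¹ ^ j)
  refine h1.congr (Filter.Eventually.of_forall fun ζ => ?_)
  have hpi := Real.pi_ne_zero
  simp only [fourierInv_iterate_quadDiffOp hS]
  simp only [norm_mul, norm_pow, norm_neg, Complex.norm_real, Real.norm_eq_abs,
    abs_of_pos Real.pi_pos, Complex.norm_ofNat]
  rw [mul_pow, ← mul_assoc, ← mul_assoc, ← mul_pow, inv_mul_cancel₀ (by positivity), one_pow,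
    one_mul]

/-- The Fourier side of the oscillatory integral is `O(|l| ^ (-M))` for every `M` when the
critical point `(2l)⁻¹ • S y` of the phase is off the support, and it is always bounded. -/
theorem exists_norm_integral_fourierInv_mul_quad_le {S : E →ₗ[ℝ] E} (hS : S.IsSymmetric)
    (h : 𝓢(E, ℂ)) (M : ℕ) : ∃ C : ℝ, 0 ≤ C ∧ ∀ (l : ℝ), l ≠ 0 → ∀ y : E,
      (M = 0 ∨ (2 * l)⁻¹ • S y ∉ tsupport h) →
      ‖∫ ζ, 𝓕⁻ h ζ * Complex.exp
        (((Real.pi * inner ℝ (S (y - ζ)) (y - ζ) / (2 * l) : ℝ) : ℂ) * Complex.I)‖ ≤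
        C * |l|⁻¹ ^ M := by
  obtain ⟨C, hC, hexp⟩ := exists_norm_exp_mul_I_sub_sum_le M
  set A := ∫ ζ, |(inner ℝ (S ζ) ζ : ℝ)| ^ M * ‖𝓕⁻ h ζ‖ with hA
  have hA0 : 0 ≤ A := integral_nonneg fun ζ => by positivity
  refine ⟨C * (Real.pi / 2) ^ M * A, by positivity, fun l hl y hcrit => ?_⟩
  set w := (2 * l)⁻¹ • S y with hw
  set e : E → ℂ := fun ζ => Complex.exp (((-2 * Real.pi * inner ℝ ζ w : ℝ) : ℂ) * Complex.I)
    with he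
  set u : E → ℝ := fun ζ => Real.pi / (2 * l) * inner ℝ (S ζ) ζ with hu
  have hSc := S.continuous_of_finiteDimensional
  have hec : Continuous e := by rw [he]; fun_prop
  have huc : Continuous u := by rw [hu]; fun_prop
  have hnorm_e : ∀ ζ, ‖e ζ‖ = 1 := fun ζ => Complex.norm_exp_ofReal_mul_I _
  have hphase : ∀ ζ, 𝓕⁻ h ζ * Complex.exp
      (((Real.pi * inner ℝ (S (y - ζ)) (y - ζ) / (2 * l) : ℝ) : ℂ) * Complex.I) =
      Complex.exp (((Real.pi * inner ℝ (S y) y / (2 * l) : ℝ) : ℂ) * Complex.I) *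
        (e ζ * 𝓕⁻ h ζ * Complex.exp (u ζ * Complex.I)) := fun ζ => by
    have h1 : Real.pi * inner ℝ (S (y - ζ)) (y - ζ) / (2 * l) =
        Real.pi * inner ℝ (S y) y / (2 * l) + -2 * Real.pi * inner ℝ ζ w + u ζ := by
      simp only [hu, hw, map_sub, inner_sub_left, inner_sub_right, inner_smul_right]
      rw [hS ζ y, real_inner_comm ζ (S y)]
      field_simp
      ring
    rw [h1]
    simp only [he]
    push_cast
    rw [add_mul, add_mul, Complex.exp_add, Complex.exp_add]
    ring
  simp_rw [hphase]
  rw [integral_const_mul, norm_mul, Complex.norm_exp_ofReal_mul_I, one_mul]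
  have hint : ∀ j : ℕ, Integrable fun ζ => e ζ * 𝓕⁻ h ζ * ((u ζ * Complex.I) ^ j / j.factorial) := by
    intro j
    have h1 := (integrable_abs_quad_pow_mul_norm_fourierInv hS h j).const_mul
      (|Real.pi / (2 * l)| ^ j / j.factorial)
    refine h1.mono' ?_ (Filter.Eventually.of_forall fun ζ => le_of_eq ?_)
    · have := (𝓕⁻ h).continuous
      exact Continuous.aestronglyMeasurable (by fun_prop)
    · simp only [norm_mul, hnorm_e, norm_div, norm_pow, Complex.norm_I, Complex.norm_real,
        Complex.norm_natCast, hu, Real.norm_eq_abs, mul_pow, abs_mul, abs_div]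
      ring
  have hzero : ∀ j ∈ Finset.range M,
      ∫ ζ, e ζ * 𝓕⁻ h ζ * ((u ζ * Complex.I) ^ j / j.factorial) = 0 := by
    intro j hj
    have hM : M ≠ 0 := by rintro rfl; simp at hj
    have h1 := integral_quad_pow_mul_fourierInv_eq_zero hS h (hcrit.resolve_left hM) j
    rw [← mul_zero (((Real.pi / (2 * l) : ℝ) * Complex.I) ^ j / j.factorial), ← h1,
      ← integral_const_mul]
    refine integral_congr_ae (Filter.Eventually.of_forall fun ζ => ?_)
    simp only [hu, he]
    push_cast
    rw [mul_pow, mul_pow, mul_pow]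
    ring
  have hint' : Integrable fun ζ => e ζ * 𝓕⁻ h ζ * Complex.exp (u ζ * Complex.I) := by
    refine ((𝓕⁻ h).integrable (μ := volume)).norm.mono' ?_
      (Filter.Eventually.of_forall fun ζ => le_of_eq ?_)
    · have := (𝓕⁻ h).continuous
      exact Continuous.aestronglyMeasurable (by fun_prop)
    · rw [norm_mul, norm_mul, hnorm_e, Complex.norm_exp_ofReal_mul_I, one_mul, mul_one]
  -- The Taylor polynomial of the quadratic factor integrates to zero, so only the remainder counts.
  have hsub : ∫ ζ, e ζ * 𝓕⁻ h ζ * Complex.exp (u ζ * Complex.I) =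
      ∫ ζ, e ζ * 𝓕⁻ h ζ * (Complex.exp (u ζ * Complex.I) -
        ∑ j ∈ Finset.range M, (u ζ * Complex.I) ^ j / (j.factorial : ℂ)) := by
    simp_rw [mul_sub, Finset.mul_sum]
    rw [integral_sub hint' (integrable_finsetSum _ fun j _ => hint j),
      integral_finsetSum _ fun j _ => hint j, Finset.sum_eq_zero hzero, sub_zero]
  rw [hsub]
  calc _ ≤ ∫ ζ, C * (Real.pi / 2) ^ M * |l|⁻¹ ^ M * (|(inner ℝ (S ζ) ζ : ℝ)| ^ M * ‖𝓕⁻ h ζ‖) := by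
        refine norm_integral_le_of_norm_le
          ((integrable_abs_quad_pow_mul_norm_fourierInv hS h M).const_mul _)
          (Filter.Eventually.of_forall fun ζ => ?_)
        rw [norm_mul, norm_mul, hnorm_e, one_mul]
        calc _ ≤ ‖𝓕⁻ h ζ‖ * (C * |u ζ| ^ M) := by gcongr; exact hexp _
          _ = _ := by
            simp only [hu, abs_mul, abs_div, abs_of_pos Real.pi_pos, Nat.abs_ofNat]
            rw [mul_pow, div_pow, div_pow, inv_pow, mul_pow]
            field_simp
    _ = _ := by rw [integral_const_mul]; ring

end QuadraticPhase

/-! ### The dispersive estimate for the wave form -/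

/-- The time reflection `(ξ, τ) ↦ (ξ, -τ)`, the symmetric map that represents `waveForm`. -/
def timeReflection (d : ℕ) : SpaceTime d →ₗ[ℝ] SpaceTime d where
  toFun z := WithLp.toLp 2 (z.fst, -z.snd)
  map_add' x y := by
    apply WithLp.ofLp_injective 2
    ext1
    · rfl
    · simp [add_comm]
  map_smul' c x := by
    apply WithLp.ofLp_injective 2
    ext1
    · rfl
    · simp

theorem timeReflection_fst {d : ℕ} (z : SpaceTime d) : (timeReflection d z).fst = z.fst := rfl

theorem timeReflection_snd {d : ℕ} (z : SpaceTime d) : (timeReflection d z).snd = -z.snd := rfl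

theorem inner_spaceTime {d : ℕ} (x y : SpaceTime d) :
    inner ℝ x y = inner ℝ x.fst y.fst + inner ℝ x.snd y.snd :=
  WithLp.prod_inner_apply x y

theorem isSymmetric_timeReflection (d : ℕ) : (timeReflection d).IsSymmetric := fun x y => by
  simp [WithLp.prod_inner_apply, timeReflection_fst, timeReflection_snd]

theorem norm_timeReflection {d : ℕ} (z : SpaceTime d) : ‖timeReflection d z‖ = ‖z‖ := by
  rw [← sq_eq_sq₀ (norm_nonneg _) (norm_nonneg _), WithLp.prod_norm_sq_eq_of_L2,
    WithLp.prod_norm_sq_eq_of_L2]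
  simp [timeReflection_fst, timeReflection_snd]

theorem waveForm_eq_inner {d : ℕ} (z : SpaceTime d) :
    waveForm z = inner ℝ (timeReflection d z) z := by
  simp [WithLp.prod_inner_apply, timeReflection_fst, timeReflection_snd, waveForm]
  ring

theorem integrable_fst_mul_snd {d : ℕ} {f : EuclideanSpace ℝ (Fin d) → ℂ} {g : ℝ → ℂ}
    (hf : Integrable f) (hg : Integrable g) :
    Integrable fun z : SpaceTime d => f z.fst * g z.snd :=
  (WithLp.volume_preserving_ofLp (EuclideanSpace ℝ (Fin d)) ℝ).integrable_comp_of_integrable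
    (hf.mul_prod hg)

theorem integral_spaceTime {d : ℕ} (f : EuclideanSpace ℝ (Fin d) × ℝ → ℂ) :
    ∫ z : SpaceTime d, f (z.fst, z.snd) = ∫ p, f p :=
  (WithLp.volume_preserving_ofLp (EuclideanSpace ℝ (Fin d)) ℝ).integral_comp
    (MeasurableEquiv.toLp 2 (EuclideanSpace ℝ (Fin d) × ℝ)).symm.measurableEmbedding f

theorem fourier_fst_mul_snd {d : ℕ} (f : EuclideanSpace ℝ (Fin d) → ℂ) (g : ℝ → ℂ)
    (w : SpaceTime d) :
    𝓕 (fun z : SpaceTime d => f z.fst * g z.snd) w = 𝓕 f w.fst * 𝓕 g w.snd := by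
  simp only [Real.fourier_eq']
  rw [← integral_prod_mul, ← Measure.volume_eq_prod, ← integral_spaceTime]
  congr 1
  ext z
  rw [inner_spaceTime]
  simp only [smul_eq_mul, mul_add, Complex.ofReal_add, add_mul, Complex.exp_add]
  ring

/-- The damped oscillating factor `exp (-ε ‖z‖²) * quadPhase (timeReflection d) l y z`. -/
def dampedPhase {d : ℕ} (ε l : ℝ) (y z : SpaceTime d) : ℂ :=
  Complex.exp (-(ε + 2 * Real.pi * l * Complex.I) * ‖z.fst‖ ^ 2 +
    2 * Real.pi * Complex.I * inner ℝ y.fst z.fst) *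
  Complex.exp (-(ε - 2 * Real.pi * l * Complex.I) * ‖z.snd‖ ^ 2 +
    2 * Real.pi * Complex.I * inner ℝ y.snd z.snd)

theorem dampedPhase_eq {d : ℕ} (ε l : ℝ) (y z : SpaceTime d) :
    dampedPhase ε l y z =
      Complex.exp ((-ε * ‖z‖ ^ 2 : ℝ)) * quadPhase (timeReflection d) l y z := by
  rw [dampedPhase, quadPhase, ← Complex.exp_add, ← Complex.exp_add, ← waveForm_eq_inner, waveForm,
    WithLp.prod_norm_sq_eq_of_L2, inner_spaceTime]
  congr 1
  rw [Real.norm_eq_abs, real_inner_comm z.fst, real_inner_comm z.snd]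
  push_cast
  have : ((|z.snd| : ℝ) : ℂ) ^ 2 = (z.snd : ℂ) ^ 2 := by
    rw [← Complex.ofReal_pow, sq_abs, Complex.ofReal_pow]
  change _ + (_ * ((|z.snd| : ℝ) : ℂ) ^ 2 + _) = -_ * (_ + ((|z.snd| : ℝ) : ℂ) ^ 2) + _
  rw [this]
  ring

theorem integrable_dampedPhase {d : ℕ} {ε : ℝ} (hε : 0 < ε) (l : ℝ) (y : SpaceTime d) :
    Integrable (dampedPhase ε l y) :=
  integrable_fst_mul_snd
    (GaussianFourier.integrable_cexp_neg_mul_sq_norm_add (by simpa using hε) _ _)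
    (GaussianFourier.integrable_cexp_neg_mul_sq_norm_add (by simpa using hε) _ _)

theorem fourier_dampedPhase {d : ℕ} {ε : ℝ} (hε : 0 < ε) (l : ℝ) (y ζ : SpaceTime d) :
    𝓕 (dampedPhase ε l y) ζ =
      ((Real.pi / (ε + 2 * Real.pi * l * Complex.I)) ^ (d / 2 : ℂ) *
        (Real.pi / (ε - 2 * Real.pi * l * Complex.I)) ^ (1 / 2 : ℂ)) *
      (Complex.exp (-Real.pi ^ 2 * ‖y.fst - ζ.fst‖ ^ 2 / (ε + 2 * Real.pi * l * Complex.I)) *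
        Complex.exp (-Real.pi ^ 2 * ‖y.snd - ζ.snd‖ ^ 2 / (ε - 2 * Real.pi * l * Complex.I))) := by
  have h1 := fourier_fst_mul_snd (d := d)
    (fun v => Complex.exp (-(ε + 2 * Real.pi * l * Complex.I) * ‖v‖ ^ 2 +
      2 * Real.pi * Complex.I * inner ℝ y.fst v))
    (fun v => Complex.exp (-(ε - 2 * Real.pi * l * Complex.I) * ‖v‖ ^ 2 +
      2 * Real.pi * Complex.I * inner ℝ y.snd v)) ζ
  rw [fourier_gaussian_innerProductSpace' (by simpa using hε),
    fourier_gaussian_innerProductSpace' (by simpa using hε)] at h1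
  refine h1.trans ?_
  simp only [finrank_euclideanSpace_fin, Module.finrank_self, Nat.cast_one]
  ring

open Filter Topology in
/-- The Gaussian Fourier transform at purely imaginary width: a Fourier-side formula for the
oscillatory integral, obtained by letting the damping tend to zero. -/
theorem quadOscInt_timeReflection_eq {d : ℕ} (h : 𝓢(SpaceTime d, ℂ)) {l : ℝ} (hl : l ≠ 0)
    (y : SpaceTime d) :
    quadOscInt (timeReflection d) h l y =
      ((Real.pi / (2 * Real.pi * l * Complex.I)) ^ (d / 2 : ℂ) *
        (Real.pi / (-(2 * Real.pi * l * Complex.I))) ^ (1 / 2 : ℂ)) *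
      ∫ ζ, 𝓕⁻ h ζ * Complex.exp (((Real.pi *
        inner ℝ (timeReflection d (y - ζ)) (y - ζ) / (2 * l) : ℝ) : ℂ) * Complex.I) := by
  have hflip : ∀ ε : ℝ, 0 < ε → ∫ z, h z * dampedPhase ε l y z =
      ∫ ζ, 𝓕⁻ h ζ * 𝓕 (dampedPhase ε l y) ζ := by
    intro ε hε
    have h1 := VectorFourier.integral_fourierIntegral_smul_eq_flip (L := innerₗ (SpaceTime d))
      Real.continuous_fourierChar continuous_inner ((𝓕⁻ h).integrable (μ := volume))
      (integrable_dampedPhase hε l y)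
    rw [flip_innerₗ] at h1
    have h2 : ∀ z, 𝓕 (𝓕⁻ h) z = h z := fun z => by rw [FourierTransform.fourier_fourierInv_eq]
    simp_rw [← h2]
    exact h1
  have hpi := Real.pi_pos
  have hI : (2 * Real.pi * l * Complex.I : ℂ) ≠ 0 := by
    simp [hl, hpi.ne']
  -- Off the limit `ε = 0` the Fourier transform is absolutely convergent; both sides converge by
  -- dominated convergence.
  have hleft : Tendsto (fun ε : ℝ => ∫ z, h z * dampedPhase ε l y z) (𝓝[>] 0)
      (𝓝 (quadOscInt (timeReflection d) h l y)) := by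
    refine tendsto_integral_filter_of_dominated_convergence (fun z => ‖h z‖) ?_ ?_
      h.integrable.norm ?_
    · filter_upwards [self_mem_nhdsWithin] with ε hε
      exact h.continuous.aestronglyMeasurable.mul
        (integrable_dampedPhase hε l y).aestronglyMeasurable
    · filter_upwards [self_mem_nhdsWithin] with ε hε
      refine Eventually.of_forall fun z => ?_
      rw [dampedPhase_eq, norm_mul, norm_mul, norm_quadPhase, mul_one, ← Complex.ofReal_exp,
        Complex.norm_real, Real.norm_eq_abs, Real.abs_exp]
      refine mul_le_of_le_one_right (norm_nonneg _) (Real.exp_le_one_iff.2 ?_)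
      have : 0 < ε := hε
      nlinarith [sq_nonneg ‖z‖]
    · refine Eventually.of_forall fun z => ?_
      have : Continuous fun ε : ℝ => h z * dampedPhase ε l y z := by
        simp_rw [dampedPhase_eq]; fun_prop
      have h1 := (this.tendsto 0).mono_left (nhdsWithin_le_nhds (s := Set.Ioi 0))
      rw [dampedPhase_eq] at h1
      simpa [mul_comm] using h1
  have hb1 : Tendsto (fun ε : ℝ => (ε + 2 * Real.pi * l * Complex.I : ℂ)) (𝓝[>] 0)
      (𝓝 (2 * Real.pi * l * Complex.I)) := by
    have : Continuous fun ε : ℝ => (ε + 2 * Real.pi * l * Complex.I : ℂ) := by fun_prop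
    simpa using (this.tendsto 0).mono_left (nhdsWithin_le_nhds (s := Set.Ioi 0))
  have hb2 : Tendsto (fun ε : ℝ => (ε - 2 * Real.pi * l * Complex.I : ℂ)) (𝓝[>] 0)
      (𝓝 (-(2 * Real.pi * l * Complex.I))) := by
    have : Continuous fun ε : ℝ => (ε - 2 * Real.pi * l * Complex.I : ℂ) := by fun_prop
    simpa using (this.tendsto 0).mono_left (nhdsWithin_le_nhds (s := Set.Ioi 0))
  have hslit1 : (Real.pi / (2 * Real.pi * l * Complex.I) : ℂ) ∈ Complex.slitPlane := by
    right
    have : (Real.pi / (2 * Real.pi * l * Complex.I) : ℂ) = ((-(1 / (2 * l)) : ℝ) : ℂ) * Complex.I := by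
      have := Complex.I_ne_zero
      have hl' : (l : ℂ) ≠ 0 := by exact_mod_cast hl
      have hpi' : (Real.pi : ℂ) ≠ 0 := by exact_mod_cast hpi.ne'
      push_cast
      field_simp
      simp
    rw [this]
    simp [hl]
  have hslit2 : (Real.pi / (-(2 * Real.pi * l * Complex.I)) : ℂ) ∈ Complex.slitPlane := by
    right
    have : (Real.pi / (-(2 * Real.pi * l * Complex.I)) : ℂ) = ((1 / (2 * l) : ℝ) : ℂ) * Complex.I := by
      have := Complex.I_ne_zero
      have hl' : (l : ℂ) ≠ 0 := by exact_mod_cast hl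
      have hpi' : (Real.pi : ℂ) ≠ 0 := by exact_mod_cast hpi.ne'
      push_cast
      field_simp
      simp
    rw [this]
    simp [hl]
  have hconst : Tendsto (fun ε : ℝ =>
      ((Real.pi / (ε + 2 * Real.pi * l * Complex.I)) ^ (d / 2 : ℂ) *
        (Real.pi / (ε - 2 * Real.pi * l * Complex.I)) ^ (1 / 2 : ℂ) : ℂ)) (𝓝[>] 0)
      (𝓝 ((Real.pi / (2 * Real.pi * l * Complex.I)) ^ (d / 2 : ℂ) *
        (Real.pi / (-(2 * Real.pi * l * Complex.I))) ^ (1 / 2 : ℂ))) :=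
    ((tendsto_const_nhds.div hb1 hI).cpow tendsto_const_nhds hslit1).mul
      ((tendsto_const_nhds.div hb2 (neg_ne_zero.2 hI)).cpow tendsto_const_nhds hslit2)
  have hexp_le : ∀ (ε c r : ℝ), 0 < ε →
      ‖Complex.exp (-Real.pi ^ 2 * r ^ 2 / (ε + c * Complex.I))‖ ≤ 1 := by
    intro ε c r hε
    rw [Complex.norm_exp]
    refine Real.exp_le_one_iff.2 ?_
    have : (-(Real.pi : ℂ) ^ 2 * r ^ 2 / (ε + c * Complex.I)) =
        ((-(Real.pi ^ 2 * r ^ 2) : ℝ) : ℂ) * (ε + c * Complex.I)⁻¹ := by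
      push_cast; ring
    rw [this, Complex.re_ofReal_mul, Complex.inv_re]
    have h1 : (0 : ℝ) ≤ (ε + c * Complex.I : ℂ).re / Complex.normSq (ε + c * Complex.I) :=
      div_nonneg (by simpa using hε.le) (Complex.normSq_nonneg _)
    nlinarith [mul_nonneg (by positivity : 0 ≤ Real.pi ^ 2 * r ^ 2) h1]
  have hright : Tendsto (fun ε : ℝ => ∫ ζ, 𝓕⁻ h ζ *
      (Complex.exp (-Real.pi ^ 2 * ‖y.fst - ζ.fst‖ ^ 2 / (ε + 2 * Real.pi * l * Complex.I)) *
        Complex.exp (-Real.pi ^ 2 * ‖y.snd - ζ.snd‖ ^ 2 / (ε - 2 * Real.pi * l * Complex.I))))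
      (𝓝[>] 0) (𝓝 (∫ ζ, 𝓕⁻ h ζ * Complex.exp (((Real.pi *
        inner ℝ (timeReflection d (y - ζ)) (y - ζ) / (2 * l) : ℝ) : ℂ) * Complex.I))) := by
    have hfst : Continuous fun z : SpaceTime d => z.fst := WithLp.continuous_fst ..
    have hsnd : Continuous fun z : SpaceTime d => z.snd := WithLp.continuous_snd ..
    refine tendsto_integral_filter_of_dominated_convergence (fun ζ => ‖𝓕⁻ h ζ‖) ?_ ?_
      (𝓕⁻ h).integrable.norm ?_
    · refine Eventually.of_forall fun ε => (𝓕⁻ h).continuous.aestronglyMeasurable.mul ?_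
      refine Continuous.aestronglyMeasurable ?_
      simp only [div_eq_mul_inv]
      fun_prop
    · filter_upwards [self_mem_nhdsWithin] with ε hε
      refine Eventually.of_forall fun ζ => ?_
      rw [norm_mul, norm_mul]
      have h1 := hexp_le ε (2 * Real.pi * l) ‖y.fst - ζ.fst‖ hε
      have h2 := hexp_le ε (-(2 * Real.pi * l)) ‖y.snd - ζ.snd‖ hε
      push_cast at h1 h2
      rw [neg_mul (2 * (Real.pi : ℂ) * l) Complex.I, ← sub_eq_add_neg] at h2
      exact mul_le_of_le_one_right (norm_nonneg _) (mul_le_one₀ h1 (norm_nonneg _) h2)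
    · refine Eventually.of_forall fun ζ => Tendsto.const_mul _ ?_
      have h1 := (((tendsto_const_nhds (x := -(Real.pi : ℂ) ^ 2 * ‖y.fst - ζ.fst‖ ^ 2)).div
        hb1 hI).cexp).mul (((tendsto_const_nhds
          (x := -(Real.pi : ℂ) ^ 2 * ‖y.snd - ζ.snd‖ ^ 2)).div hb2 (neg_ne_zero.2 hI)).cexp)
      refine (Eq.subst (motive := fun a => Tendsto _ _ (𝓝 a)) ?_ h1)
      rw [← Complex.exp_add, ← waveForm_eq_inner, waveForm]
      congr 1
      have hl' : (l : ℂ) ≠ 0 := by exact_mod_cast hl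
      have hpi' : (Real.pi : ℂ) ≠ 0 := by exact_mod_cast hpi.ne'
      have hsq : ((‖y.snd - ζ.snd‖ : ℝ) : ℂ) ^ 2 = ((y - ζ).snd : ℂ) ^ 2 := by
        rw [Real.norm_eq_abs, ← Complex.ofReal_pow, sq_abs, Complex.ofReal_pow]; rfl
      have hfs : (y - ζ).fst = y.fst - ζ.fst := rfl
      rw [hsq, hfs]
      push_cast
      field_simp
      rw [Complex.I_sq]
      ring
  refine tendsto_nhds_unique hleft ((hconst.mul hright).congr' ?_)
  filter_upwards [self_mem_nhdsWithin] with ε hε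
  rw [hflip ε hε, ← integral_const_mul]
  refine integral_congr_ae (Eventually.of_forall fun ζ => ?_)
  simp only [fourier_dampedPhase hε]
  ring

theorem norm_quadOscInt_timeReflection_eq {d : ℕ} (h : 𝓢(SpaceTime d, ℂ)) {l : ℝ} (hl : l ≠ 0)
    (y : SpaceTime d) :
    ‖quadOscInt (timeReflection d) h l y‖ = (2 * |l|)⁻¹ ^ (((d : ℝ) + 1) / 2) *
      ‖∫ ζ, 𝓕⁻ h ζ * Complex.exp (((Real.pi *
        inner ℝ (timeReflection d (y - ζ)) (y - ζ) / (2 * l) : ℝ) : ℂ) * Complex.I)‖ := by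
  rw [quadOscInt_timeReflection_eq h hl, norm_mul, norm_mul]
  congr 1
  have hpi := Real.pi_pos
  have h1 : ‖(Real.pi / (2 * Real.pi * l * Complex.I) : ℂ)‖ = (2 * |l|)⁻¹ := by
    simp [abs_of_pos hpi]
    field_simp
  have h2 : ‖(Real.pi / (-(2 * Real.pi * l * Complex.I)) : ℂ)‖ = (2 * |l|)⁻¹ := by
    rw [div_neg, norm_neg, h1]
  have e1 : (d / 2 : ℂ) = ((d / 2 : ℝ) : ℂ) := by push_cast; rfl
  have e2 : (1 / 2 : ℂ) = ((1 / 2 : ℝ) : ℂ) := by push_cast; rfl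
  rw [e1, e2, Complex.norm_cpow_real, Complex.norm_cpow_real, h1, h2, ← Real.rpow_add (by positivity)]
  congr 1
  ring

/-- For `h` supported in the annulus, the critical point `(2l)⁻¹ • timeReflection y` of the phase
meets the support only when `|l|` is comparable with `‖y‖`. There the dispersive bound
`|l| ^ (-(d + 1) / 2)` is used; for all other `l` the integral is much smaller. -/
theorem exists_norm_quadOscInt_timeReflection_le {d : ℕ} (hd : 1 ≤ d) (h : 𝓢(SpaceTime d, ℂ))
    (hsupp : tsupport h ⊆ {z | 1 / 4 ≤ ‖z‖ ∧ ‖z‖ ≤ 5 / 4}) :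
    ∃ C : ℝ, 0 ≤ C ∧ ∀ (l : ℝ) (y : SpaceTime d),
      ‖quadOscInt (timeReflection d) h l y‖ ≤
        C * (1 + ‖y‖) ^ (-(((d : ℝ) + 1) / 2)) * (1 + (l / (1 + ‖y‖)) ^ 2)⁻¹ := by
  have hS := isSymmetric_timeReflection d
  obtain ⟨C₁, hC₁, hb₁⟩ := exists_pow_mul_norm_quadOscInt_le hS (d + 1) h
  obtain ⟨C₂, hC₂, hb₂⟩ := exists_norm_integral_fourierInv_mul_quad_le hS h 0
  obtain ⟨C₃, hC₃, hb₃⟩ := exists_norm_integral_fourierInv_mul_quad_le hS h (d + 1)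
  set p : ℝ := ((d : ℝ) + 1) / 2 with hp
  have hp0 : 0 ≤ p := by positivity
  have h2p : (2 * p) = ((d + 1 : ℕ) : ℝ) := by rw [hp]; push_cast; ring
  refine ⟨10 * (C₁ * 2 ^ (d + 1) + C₃ + C₂ * 5 ^ p), by positivity, fun l y => ?_⟩
  set Y := 1 + ‖y‖ with hY
  have hY1 : 1 ≤ Y := by rw [hY]; linarith [norm_nonneg y]
  have hY0 : 0 < Y := by linarith
  have hYp : 0 < Y ^ (-p) := Real.rpow_pos_of_pos hY0 _
  have hW : 0 < 1 + (l / Y) ^ 2 := by positivity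
  set K := ‖quadOscInt (timeReflection d) h l y‖ with hK
  have hC₅ : 0 ≤ C₂ * 5 ^ p := by positivity
  have hC₆ : 0 ≤ C₁ * 2 ^ (d + 1) := by positivity
  rw [le_mul_inv_iff₀ hW]
  have hsq : √Y ^ (d + 1) = Y ^ p := by
    rw [Real.sqrt_eq_rpow, ← Real.rpow_natCast, ← Real.rpow_mul hY0.le, ← h2p]
    congr 1
    ring
  have hinv : Y ^ (-p) = (Y ^ p)⁻¹ := Real.rpow_neg hY0.le p
  have hYpp : 0 < Y ^ p := Real.rpow_pos_of_pos hY0 p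
  -- It suffices to bound the integral by `Y ^ (-p)` when `|l| ≤ 3 * Y`.
  have hsmall : ∀ a : ℝ, 0 ≤ a → |l| ≤ 3 * Y → a ≤ C₁ * 2 ^ (d + 1) + C₃ + C₂ * 5 ^ p →
      K ≤ a * Y ^ (-p) → K * (1 + (l / Y) ^ 2) ≤
        10 * (C₁ * 2 ^ (d + 1) + C₃ + C₂ * 5 ^ p) * Y ^ (-p) := by
    intro a ha hl haC hKa
    have h1 : (l / Y) ^ 2 ≤ 3 ^ 2 := by
      rw [← sq_abs, abs_div, abs_of_pos hY0]
      gcongr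
      rwa [div_le_iff₀ hY0]
    calc K * (1 + (l / Y) ^ 2) ≤ (a * Y ^ (-p)) * 10 := by
          apply mul_le_mul hKa (by linarith) hW.le (by positivity)
      _ = 10 * a * Y ^ (-p) := by ring
      _ ≤ _ := by gcongr
  have hsqrt1 : 1 ≤ √Y := Real.one_le_sqrt.2 hY1
  have hsqrtY : √Y ≤ Y := Real.sqrt_le_self_iff.2 (Or.inr hY1)
  rcases le_or_gt |l| √Y with h1 | h1
  · -- Integration by parts: `d + 1` steps gain `(|l| / Y) ^ (d + 1) ≤ √Y ^ (-(d + 1)) = Y ^ (-p)`.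
    refine hsmall (C₁ * 2 ^ (d + 1)) hC₆ (by linarith) (by linarith) ?_
    have h2 := hb₁ l y
    rw [← hY, ← hK] at h2
    have h3 : Y ^ (d + 1) = Y ^ p * Y ^ p := by
      rw [← Real.rpow_add hY0, ← two_mul, h2p, Real.rpow_natCast]
    have h4 : (1 + |l|) ^ (d + 1) ≤ 2 ^ (d + 1) * Y ^ p := by
      rw [← hsq, ← mul_pow]
      gcongr
      linarith
    rw [hinv, le_mul_inv_iff₀ hYpp]
    have h5 : Y ^ p * (K * Y ^ p) ≤ Y ^ p * (C₁ * 2 ^ (d + 1)) := by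
      calc _ = Y ^ (d + 1) * K := by rw [h3]; ring
        _ ≤ C₁ * (1 + |l|) ^ (d + 1) := h2
        _ ≤ C₁ * (2 ^ (d + 1) * Y ^ p) := by gcongr
        _ = _ := by ring
    exact le_of_mul_le_mul_left h5 hYpp
  have hl1 : 1 < |l| := lt_of_le_of_lt hsqrt1 h1
  have hl0 : l ≠ 0 := by rintro rfl; simp at hl1; linarith
  have hform := norm_quadOscInt_timeReflection_eq h hl0 y
  rw [← hp, ← hK] at hform
  have hlp : (2 * |l|)⁻¹ ^ p ≤ 1 :=
    Real.rpow_le_one (by positivity) (inv_le_one_of_one_le₀ (by linarith)) hp0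
  have hlp0 : 0 ≤ (2 * |l|)⁻¹ ^ p := by positivity
  -- The norm of the critical point `(2l)⁻¹ S y` is `‖y‖ / (2|l|)`.
  have hw : ‖(2 * l)⁻¹ • timeReflection d y‖ * (2 * |l|) = Y - 1 := by
    rw [norm_smul, norm_timeReflection, norm_inv, norm_mul, Real.norm_eq_abs, Real.norm_eq_abs,
      Nat.abs_ofNat, hY]
    field_simp
    ring
  rcases le_or_gt |l| (Y / 10) with h2 | h2
  · -- The critical point lies outside the annulus, at distance more than `5 / 4` from the origin
    -- (`Y` is large, since `√Y < |l| ≤ Y / 10`). The gain `|l| ^ (-(d + 1))` suffices as `|l| > √Y`.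
    refine hsmall C₃ hC₃ (by linarith) (by linarith) ?_
    have hcrit : (2 * l)⁻¹ • timeReflection d y ∉ tsupport h := fun hmem => by
      have := (hsupp hmem).2
      nlinarith
    have h3 := hb₃ l hl0 y (Or.inr hcrit)
    rw [hform]
    calc _ ≤ 1 * (C₃ * |l|⁻¹ ^ (d + 1)) := by gcongr
      _ ≤ 1 * (C₃ * (√Y)⁻¹ ^ (d + 1)) := by gcongr
      _ = _ := by rw [inv_pow, hsq, hinv, one_mul]
  rcases le_or_gt |l| (3 * Y) with h3 | h3
  · -- The dispersive bound, here with `|l|` comparable to `Y`.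
    refine hsmall (C₂ * 5 ^ p) hC₅ h3 (by linarith) ?_
    have h4 := hb₂ l hl0 y (Or.inl rfl)
    rw [pow_zero, mul_one] at h4
    rw [hform]
    calc _ ≤ (5 * Y⁻¹) ^ p * C₂ := by
          gcongr
          rw [← div_eq_mul_inv, inv_le_comm₀ (by positivity) (by positivity), inv_div]
          linarith
      _ = _ := by
          rw [Real.mul_rpow (by norm_num) (by positivity), Real.inv_rpow hY0.le, hinv]; ring
  · -- The critical point lies inside the inner ball `‖z‖ < 1 / 4`. Since `d + 1 ≥ 2`, the gain
    -- `|l| ^ (-(d + 1))` also provides the integrable factor in `l`.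
    have hcrit : (2 * l)⁻¹ • timeReflection d y ∉ tsupport h := fun hmem => by
      have := (hsupp hmem).1
      nlinarith
    have h4 := hb₃ l hl0 y (Or.inr hcrit)
    have h5 : (2 * |l|)⁻¹ ^ p ≤ Y ^ (-p) := by
      rw [hinv, ← Real.inv_rpow hY0.le]
      gcongr
      linarith
    have h6 : |l|⁻¹ ^ (d + 1) ≤ |l|⁻¹ ^ 2 :=
      pow_le_pow_of_le_one (by positivity) (inv_le_one_of_one_le₀ hl1.le) (by omega)
    have h7 : 1 + (l / Y) ^ 2 ≤ 2 * |l| ^ 2 := by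
      have h8 : (l / Y) ^ 2 ≤ |l| ^ 2 := by
        rw [← sq_abs, abs_div, abs_of_pos hY0]
        gcongr
        exact div_le_self (abs_nonneg l) hY1
      nlinarith
    have hKle : K ≤ Y ^ (-p) * (C₃ * |l|⁻¹ ^ 2) := by
      rw [hform]
      gcongr
      exact h4.trans (by gcongr)
    calc K * (1 + (l / Y) ^ 2) ≤ Y ^ (-p) * (C₃ * |l|⁻¹ ^ 2) * (2 * |l| ^ 2) := by gcongr
      _ = 2 * C₃ * Y ^ (-p) := by
        have : |l| ≠ 0 := by positivity
        field_simp
      _ ≤ _ := by gcongr <;> linarith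

theorem continuous_quadOscInt {E : Type*} [NormedAddCommGroup E] [InnerProductSpace ℝ E]
    [FiniteDimensional ℝ E] [MeasurableSpace E] [BorelSpace E] (S : E →ₗ[ℝ] E) {h : E → ℂ}
    (hh : Integrable h) (y : E) : Continuous fun l => quadOscInt S h l y := by
  refine continuous_of_dominated (bound := fun z => ‖h z‖)
    (fun l => (integrable_quadPhase_mul hh S l y).aestronglyMeasurable)
    (fun l => Filter.Eventually.of_forall fun z => ?_) hh.norm
    (Filter.Eventually.of_forall fun z => ?_)
  · rw [norm_mul, norm_quadPhase, one_mul]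
  · unfold quadPhase
    fun_prop

/-- The factor `(1 + (l / (1 + ‖y‖)) ^ 2)⁻¹` has integral `π (1 + ‖y‖)` over `l`, so integrating the
pointwise bound costs one power of `1 + ‖y‖`. -/
theorem exists_integral_norm_quadOscInt_timeReflection_le {d : ℕ} (hd : 1 ≤ d)
    (h : 𝓢(SpaceTime d, ℂ)) (hsupp : tsupport h ⊆ {z | 1 / 4 ≤ ‖z‖ ∧ ‖z‖ ≤ 5 / 4}) :
    ∃ C : ℝ, 0 ≤ C ∧ ∀ y : SpaceTime d,
      Integrable (fun l => quadOscInt (timeReflection d) h l y) ∧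
      ∫ l, ‖quadOscInt (timeReflection d) h l y‖ ≤ C * (1 + ‖y‖) ^ ((2 - ((d : ℝ) + 1)) / 2) := by
  obtain ⟨C, hC, hb⟩ := exists_norm_quadOscInt_timeReflection_le hd h hsupp
  refine ⟨C * Real.pi, by positivity, fun y => ?_⟩
  have hY0 : 0 < 1 + ‖y‖ := by positivity
  have hint : Integrable fun l : ℝ => C * (1 + ‖y‖) ^ (-(((d : ℝ) + 1) / 2)) *
      (1 + (l / (1 + ‖y‖)) ^ 2)⁻¹ :=
    (integrable_inv_one_add_sq.comp_div hY0.ne').const_mul _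
  refine ⟨hint.mono' (continuous_quadOscInt _ h.integrable y).aestronglyMeasurable
    (Filter.Eventually.of_forall fun l => hb l y), ?_⟩
  refine (integral_mono_of_nonneg (Filter.Eventually.of_forall fun l => norm_nonneg _) hint
    (Filter.Eventually.of_forall fun l => hb l y)).trans (le_of_eq ?_)
  rw [integral_const_mul, Measure.integral_comp_div (fun u : ℝ => (1 + u ^ 2)⁻¹),
    integral_univ_inv_one_add_sq, abs_of_pos hY0, smul_eq_mul]
  have : (1 + ‖y‖) ^ ((2 - ((d : ℝ) + 1)) / 2) =
      (1 + ‖y‖) ^ (-(((d : ℝ) + 1) / 2)) * (1 + ‖y‖) := by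
    rw [← Real.rpow_add_one hY0.ne']
    congr 1
    ring
  rw [this]
  ring

/-! ### The surface measure as a sum of two graphs -/

/-- The upper sheet `τ = √(‖ξ‖² - s)` of the hyperboloid, as a function of `ξ`. Where
`‖ξ‖² ≤ s`, so that there is no point over `ξ`, its value is `0`. -/
def sheetHeight {d : ℕ} (s : ℝ) (ξ : EuclideanSpace ℝ (Fin d)) : ℝ := √(‖ξ‖ ^ 2 - s)

theorem continuous_sheetHeight {d : ℕ} (s : ℝ) :
    Continuous (sheetHeight s : EuclideanSpace ℝ (Fin d) → ℝ) := by
  unfold sheetHeight; fun_prop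

theorem sheetHeight_pos {d : ℕ} {s : ℝ} {ξ : EuclideanSpace ℝ (Fin d)} (h : s < ‖ξ‖ ^ 2) :
    0 < sheetHeight s ξ := Real.sqrt_pos.2 (sub_pos.2 h)

theorem hasStrictFDerivAt_sheetHeight {d : ℕ} {s : ℝ} {ξ : EuclideanSpace ℝ (Fin d)}
    (h : s < ‖ξ‖ ^ 2) :
    HasStrictFDerivAt (sheetHeight s) (innerSL ℝ ((sheetHeight s ξ)⁻¹ • ξ)) ξ := by
  have h1 := ((hasStrictFDerivAt_norm_sq ξ).sub_const s).sqrt (sub_pos.2 h).ne'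
  refine h1.congr_fderiv ?_
  ext v
  have := sheetHeight_pos h
  simp [sheetHeight]
  ring

theorem levelSurface_eq_union {d : ℕ} (s : ℝ) :
    levelSurface d s = (graphMap (sheetHeight s) '' {ξ | s < ‖ξ‖ ^ 2} ∪
      graphMap (fun ξ => -sheetHeight s ξ) '' {ξ | s < ‖ξ‖ ^ 2}) ∪
      linearGraphMap (0 : EuclideanSpace ℝ (Fin d)) '' {ξ | ‖ξ‖ ^ 2 = s ∧ ξ ≠ 0} := by
  ext z
  constructor
  · rintro ⟨h1, h2⟩
    rw [waveForm] at h1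
    rcases lt_trichotomy z.snd 0 with h | h | h
    · refine Or.inl (Or.inr ⟨z.fst, ?_, ?_⟩)
      · have : 0 < z.snd ^ 2 := by nlinarith
        simp only [Set.mem_ofPred_eq]
        linarith
      · have : sheetHeight s z.fst = -z.snd := by
          rw [sheetHeight, ← h1, sub_sub_cancel, Real.sqrt_sq_eq_abs, abs_of_neg h]
        simp only [graphMap, this, neg_neg]
        rfl
    · refine Or.inr ⟨z.fst, ⟨by rw [← h1, h]; ring, fun h0 => h2 ?_⟩, ?_⟩
      · apply WithLp.ofLp_injective 2
        exact Prod.ext h0 h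
      · apply WithLp.ofLp_injective 2
        refine Prod.ext rfl ?_
        simp only [linearGraphMap, LinearMap.coe_mk, AddHom.coe_mk, inner_zero_left]
        exact h.symm
    · refine Or.inl (Or.inl ⟨z.fst, ?_, ?_⟩)
      · have : 0 < z.snd ^ 2 := by nlinarith
        simp only [Set.mem_ofPred_eq]
        linarith
      · have : sheetHeight s z.fst = z.snd := by
          rw [sheetHeight, ← h1, sub_sub_cancel, Real.sqrt_sq_eq_abs, abs_of_pos h]
        simp only [graphMap, this]
        rfl
  · rintro ((⟨ξ, hξ, rfl⟩ | ⟨ξ, hξ, rfl⟩) | ⟨ξ, ⟨hξ, h0⟩, rfl⟩)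
    · have hpos := sheetHeight_pos hξ
      refine ⟨?_, fun h => ?_⟩
      · change ‖ξ‖ ^ 2 - √(‖ξ‖ ^ 2 - s) ^ 2 = s
        rw [Real.sq_sqrt (sub_pos.2 hξ).le]
        ring
      · have : sheetHeight s ξ = 0 := congrArg (fun z : SpaceTime d => z.snd) h
        linarith
    · have hpos := sheetHeight_pos hξ
      refine ⟨?_, fun h => ?_⟩
      · change ‖ξ‖ ^ 2 - (-√(‖ξ‖ ^ 2 - s)) ^ 2 = s
        rw [neg_sq, Real.sq_sqrt (sub_pos.2 hξ).le]
        ring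
      · have : -sheetHeight s ξ = 0 := congrArg (fun z : SpaceTime d => z.snd) h
        linarith
    · refine ⟨?_, fun h => h0 ?_⟩
      · change ‖ξ‖ ^ 2 - (inner ℝ 0 ξ) ^ 2 = s
        rw [inner_zero_left, hξ]
        ring
      · exact congrArg (fun z : SpaceTime d => z.fst) h

/-- The equator `τ = 0` of the hyperboloid is a sphere of positive radius in a hyperplane, hence
a null set. -/
theorem euclideanHausdorffMeasure_equator {d : ℕ} (s : ℝ) :
    (μHE[d] : Measure (SpaceTime d))
      (linearGraphMap (0 : EuclideanSpace ℝ (Fin d)) '' {ξ | ‖ξ‖ ^ 2 = s ∧ ξ ≠ 0}) = 0 := by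
  rw [euclideanHausdorffMeasure_linearGraphMap_image]
  refine mul_eq_zero_of_right _ ?_
  rcases eq_or_ne (√s) 0 with h | h
  · convert measure_empty (μ := volume)
    ext ξ
    simp only [Set.mem_ofPred_eq, Set.mem_empty_iff_false, iff_false, not_and, not_not]
    intro h1
    rw [← h1, Real.sqrt_sq (norm_nonneg _)] at h
    exact norm_eq_zero.1 h
  · refine measure_mono_null (fun ξ hξ => ?_)
      (Measure.addHaar_sphere_of_ne_zero volume (0 : EuclideanSpace ℝ (Fin d)) h)
    rw [mem_sphere_zero_iff_norm, ← hξ.1, Real.sqrt_sq (norm_nonneg _)]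

/-- The surface element of one sheet in the coordinate `ξ`, namely `‖z‖ / τ` times Lebesgue measure.
Both sheets have the same one. -/
def sheetMeasure (d : ℕ) (s : ℝ) : Measure (EuclideanSpace ℝ (Fin d)) :=
  (volume.restrict {ξ | s < ‖ξ‖ ^ 2}).withDensity
    fun ξ => ENNReal.ofReal (‖graphMap (sheetHeight s) ξ‖ * (sheetHeight s ξ)⁻¹)

theorem sqrt_one_add_norm_gradient_sq {d : ℕ} {s : ℝ} {ξ : EuclideanSpace ℝ (Fin d)}
    (h : s < ‖ξ‖ ^ 2) : √(1 + ‖(sheetHeight s ξ)⁻¹ • ξ‖ ^ 2) =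
      ‖graphMap (sheetHeight s) ξ‖ * (sheetHeight s ξ)⁻¹ := by
  have hpos := sheetHeight_pos h
  have h1 : ‖graphMap (sheetHeight s) ξ‖ ^ 2 = ‖ξ‖ ^ 2 + sheetHeight s ξ ^ 2 := by
    rw [WithLp.prod_norm_sq_eq_of_L2, graphMap_fst, graphMap_snd, Real.norm_eq_abs, sq_abs]
  rw [← Real.sqrt_sq (by positivity : 0 ≤ ‖graphMap (sheetHeight s) ξ‖ * (sheetHeight s ξ)⁻¹)]
  congr 1
  rw [mul_pow, h1, norm_smul, norm_inv, Real.norm_eq_abs, abs_of_pos hpos]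
  field_simp
  ring

theorem restrict_sheet_eq_map {d : ℕ} (s : ℝ) {ε : ℝ} (hε : ε = 1 ∨ ε = -1) :
    (μHE[d] : Measure (SpaceTime d)).restrict
      (graphMap (fun ξ => ε * sheetHeight s ξ) '' {ξ | s < ‖ξ‖ ^ 2}) =
      (sheetMeasure d s).map (graphMap fun ξ => ε * sheetHeight s ξ) := by
  have hU : IsOpen {ξ : EuclideanSpace ℝ (Fin d) | s < ‖ξ‖ ^ 2} :=
    isOpen_lt continuous_const (by fun_prop)
  have hc := continuous_sheetHeight (d := d) s
  have hε2 : |ε| = 1 := by rcases hε with rfl | rfl <;> simp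
  rw [restrict_graph_eq_map (φ := fun ξ => ε * sheetHeight s ξ)
    (w := fun ξ => ε • (sheetHeight s ξ)⁻¹ • ξ) hU (by fun_prop)]
  · congr 1
    refine withDensity_congr_ae ?_
    filter_upwards [ae_restrict_mem hU.measurableSet] with ξ hξ
    have h1 : ‖ε • (sheetHeight s ξ)⁻¹ • ξ‖ = ‖(sheetHeight s ξ)⁻¹ • ξ‖ := by
      rw [norm_smul, Real.norm_eq_abs, hε2, one_mul]
    rw [h1, sqrt_one_add_norm_gradient_sq hξ]
  · exact ((hc.measurable.inv).smul measurable_id).const_smul ε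
  · have hinv : ContinuousOn (fun ξ => (sheetHeight s ξ)⁻¹)
        {ξ : EuclideanSpace ℝ (Fin d) | s < ‖ξ‖ ^ 2} :=
      hc.continuousOn.inv₀ fun ξ hξ => (sheetHeight_pos hξ).ne'
    exact (hinv.smul continuousOn_id).const_smul ε
  · intro ξ hξ
    refine ((hasStrictFDerivAt_sheetHeight hξ).const_mul ε).congr_fderiv ?_
    ext v
    simp

theorem surfaceMeasure_eq {d : ℕ} (s : ℝ) :
    surfaceMeasure d s = (sheetMeasure d s).map (graphMap (sheetHeight s)) +
      (sheetMeasure d s).map (graphMap fun ξ => -sheetHeight s ξ) := by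
  have h1 := restrict_sheet_eq_map (d := d) s (ε := 1) (Or.inl rfl)
  have h2 := restrict_sheet_eq_map (d := d) s (ε := -1) (Or.inr rfl)
  simp only [one_mul, neg_mul] at h1 h2
  rw [surfaceMeasure, levelSurface_eq_union, ← h1, ← h2]
  have hnull := euclideanHausdorffMeasure_equator (d := d) s
  rw [Measure.restrict_congr_set (union_ae_eq_left_of_ae_eq_empty (ae_eq_empty.2 hnull))]
  have hU : MeasurableSet {ξ : EuclideanSpace ℝ (Fin d) | s < ‖ξ‖ ^ 2} :=
    (isOpen_lt continuous_const (by fun_prop)).measurableSet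
  have hc := continuous_sheetHeight (d := d) s
  refine Measure.restrict_union ?_ ?_
  · rw [Set.disjoint_left]
    rintro _ ⟨ξ, hξ, rfl⟩ ⟨ζ, hζ, h⟩
    have h3 : -sheetHeight s ζ = sheetHeight s ξ := congrArg (fun z : SpaceTime d => z.snd) h
    linarith [sheetHeight_pos hξ, sheetHeight_pos hζ]
  · have : graphMap (fun ξ => -sheetHeight s ξ) '' {ξ : EuclideanSpace ℝ (Fin d) | s < ‖ξ‖ ^ 2} =
        {z : SpaceTime d | s < ‖z.fst‖ ^ 2 ∧ -sheetHeight s z.fst = z.snd} := by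
      ext z
      constructor
      · rintro ⟨ξ, hξ, rfl⟩; exact ⟨hξ, rfl⟩
      · rintro ⟨h3, h4⟩
        refine ⟨z.fst, h3, ?_⟩
        apply WithLp.ofLp_injective 2
        exact Prod.ext rfl h4
    rw [this]
    refine (measurable_fst_spaceTime hU).inter (measurableSet_eq_fun ?_ ?_)
    · exact (hc.measurable.comp measurable_fst_spaceTime).neg
    · exact measurable_snd.comp (WithLp.measurable_ofLp 2 _)

/-- The integrand over `ξ` which the upper sheet contributes to the integral over `waveForm = s`
of a function with weight `G`. Where there is no point over `ξ`, it vanishes since `0⁻¹ = 0`. -/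
def sheetIntegrand {d : ℕ} (G : SpaceTime d → ℂ) (s : ℝ) (ξ : EuclideanSpace ℝ (Fin d)) : ℂ :=
  ((sheetHeight s ξ)⁻¹ : ℝ) * G (graphMap (sheetHeight s) ξ)

theorem sheetHeight_of_le {d : ℕ} {s : ℝ} {ξ : EuclideanSpace ℝ (Fin d)} (h : ‖ξ‖ ^ 2 ≤ s) :
    sheetHeight s ξ = 0 := Real.sqrt_eq_zero_of_nonpos (sub_nonpos.2 h)

theorem sheetIntegrand_of_le {d : ℕ} (G : SpaceTime d → ℂ) {s : ℝ} {ξ : EuclideanSpace ℝ (Fin d)}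
    (h : ‖ξ‖ ^ 2 ≤ s) : sheetIntegrand G s ξ = 0 := by
  simp [sheetIntegrand, sheetHeight_of_le h]

theorem continuous_graphMap {d : ℕ} {φ : EuclideanSpace ℝ (Fin d) → ℝ} (hφ : Continuous φ) :
    Continuous (graphMap φ) :=
  (WithLp.prod_continuous_toLp 2 _ _).comp (continuous_id.prodMk hφ)

theorem measurable_sheetDensity {d : ℕ} (s : ℝ) : Measurable fun ξ : EuclideanSpace ℝ (Fin d) =>
    ‖graphMap (sheetHeight s) ξ‖ * (sheetHeight s ξ)⁻¹ :=
  ((continuous_graphMap (continuous_sheetHeight s)).norm.measurable).mul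
    (continuous_sheetHeight s).measurable.inv

theorem integrable_sheetMeasure_iff {d : ℕ} (s : ℝ) (f : EuclideanSpace ℝ (Fin d) → ℂ) :
    Integrable f (sheetMeasure d s) ↔ Integrable fun ξ =>
      ((‖graphMap (sheetHeight s) ξ‖ * (sheetHeight s ξ)⁻¹ : ℝ) : ℂ) * f ξ := by
  rw [sheetMeasure, integrable_withDensity_iff_integrable_smul'
    (measurable_sheetDensity s).ennreal_ofReal (Filter.Eventually.of_forall fun _ => ENNReal.ofReal_lt_top),
    ← IntegrableOn, integrableOn_iff_integrable_of_support_subset]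
  · refine integrable_congr (Filter.Eventually.of_forall fun ξ => ?_)
    have h0 : 0 ≤ ‖graphMap (sheetHeight s) ξ‖ * (sheetHeight s ξ)⁻¹ :=
      mul_nonneg (norm_nonneg _) (inv_nonneg.2 (Real.sqrt_nonneg _))
    simp only [ENNReal.toReal_ofReal h0, Complex.real_smul]
  · intro ξ hξ
    by_contra h
    refine hξ ?_
    simp [sheetHeight_of_le (not_lt.1 h)]

theorem integral_sheetMeasure {d : ℕ} (s : ℝ) (f : EuclideanSpace ℝ (Fin d) → ℂ) :
    ∫ ξ, f ξ ∂(sheetMeasure d s) = ∫ ξ,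
      ((‖graphMap (sheetHeight s) ξ‖ * (sheetHeight s ξ)⁻¹ : ℝ) : ℂ) * f ξ := by
  rw [sheetMeasure, integral_withDensity_eq_integral_toReal_smul
    (measurable_sheetDensity s).ennreal_ofReal (Filter.Eventually.of_forall fun _ => ENNReal.ofReal_lt_top),
    setIntegral_eq_integral_of_forall_compl_eq_zero]
  · refine integral_congr_ae (Filter.Eventually.of_forall fun ξ => ?_)
    have h0 : 0 ≤ ‖graphMap (sheetHeight s) ξ‖ * (sheetHeight s ξ)⁻¹ :=
      mul_nonneg (norm_nonneg _) (inv_nonneg.2 (Real.sqrt_nonneg _))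
    simp only [ENNReal.toReal_ofReal h0, Complex.real_smul]
  · intro ξ h
    simp [sheetHeight_of_le (not_lt.1 h)]

/-- The two sheets together: the sum over both signs of `τ` is carried by the weight
`‖z‖ * (F z + F (timeReflection z))` on the upper sheet. -/
theorem integral_surfaceMeasure {d : ℕ} (s : ℝ) {F : SpaceTime d → ℂ} (hF : Continuous F)
    (h₁ : Integrable (sheetIntegrand (fun z => ‖z‖ * F z) s))
    (h₂ : Integrable (sheetIntegrand (fun z => ‖z‖ * F (timeReflection d z)) s)) :
    Integrable F (surfaceMeasure d s) ∧ ∫ z, F z ∂(surfaceMeasure d s) =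
      ∫ ξ, sheetIntegrand (fun z => ‖z‖ * (F z + F (timeReflection d z))) s ξ := by
  have hc := continuous_sheetHeight (d := d) s
  have hm₁ := (continuous_graphMap hc).measurable
  have hm₂ : Measurable (graphMap fun ξ => -sheetHeight s ξ) :=
    (continuous_graphMap hc.neg).measurable
  have hi₁ : Integrable (fun ξ => F (graphMap (sheetHeight s) ξ)) (sheetMeasure d s) := by
    rw [integrable_sheetMeasure_iff]
    refine h₁.congr (Filter.Eventually.of_forall fun ξ => ?_)
    simp only [sheetIntegrand]
    push_cast
    ring
  have hi₂ : Integrable (fun ξ => F (graphMap (fun ξ => -sheetHeight s ξ) ξ))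
      (sheetMeasure d s) := by
    rw [integrable_sheetMeasure_iff]
    refine h₂.congr (Filter.Eventually.of_forall fun ξ => ?_)
    have : timeReflection d (graphMap (sheetHeight s) ξ) =
      graphMap (fun ξ => -sheetHeight s ξ) ξ := rfl
    simp only [sheetIntegrand, this]
    push_cast
    ring
  have hI₁ : Integrable F ((sheetMeasure d s).map (graphMap (sheetHeight s))) :=
    (integrable_map_measure hF.aestronglyMeasurable hm₁.aemeasurable).2 hi₁
  have hI₂ : Integrable F ((sheetMeasure d s).map (graphMap fun ξ => -sheetHeight s ξ)) :=
    (integrable_map_measure hF.aestronglyMeasurable hm₂.aemeasurable).2 hi₂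
  rw [surfaceMeasure_eq]
  refine ⟨hI₁.add_measure hI₂, ?_⟩
  rw [integral_add_measure hI₁ hI₂, integral_map hm₁.aemeasurable hF.aestronglyMeasurable,
    integral_map hm₂.aemeasurable hF.aestronglyMeasurable, ← integral_add hi₁ hi₂,
    integral_sheetMeasure]
  refine integral_congr_ae (Filter.Eventually.of_forall fun ξ => ?_)
  have : timeReflection d (graphMap (sheetHeight s) ξ) =
    graphMap (fun ξ => -sheetHeight s ξ) ξ := rfl
  simp only [sheetIntegrand, this]
  push_cast
  ring

/-! ### Dependence of the sheet integral on the level -/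

/-- A continuous weight supported in the annulus `1 / 4 ≤ ‖z‖ ≤ 5 / 4`. -/
structure IsAnnularWeight {d : ℕ} (G : SpaceTime d → ℂ) : Prop where
  continuous : Continuous G
  support_subset : ∀ z, G z ≠ 0 → 1 / 4 ≤ ‖z‖ ∧ ‖z‖ ≤ 5 / 4

theorem IsAnnularWeight.hasCompactSupport {d : ℕ} {G : SpaceTime d → ℂ} (hG : IsAnnularWeight G) :
    HasCompactSupport G :=
  HasCompactSupport.of_support_subset_isCompact (isCompact_closedBall (0 : SpaceTime d) (5 / 4))
    fun z hz => mem_closedBall_zero_iff.2 (hG.support_subset z hz).2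

theorem IsAnnularWeight.exists_norm_le {d : ℕ} {G : SpaceTime d → ℂ} (hG : IsAnnularWeight G) :
    ∃ B : ℝ, 0 ≤ B ∧ ∀ z, ‖G z‖ ≤ B := by
  obtain ⟨B, hB⟩ := hG.hasCompactSupport.exists_bound_of_continuous hG.continuous
  exact ⟨B, (norm_nonneg _).trans (hB 0), hB⟩

theorem norm_graphMap_sheetHeight_sq {d : ℕ} {s : ℝ} {ξ : EuclideanSpace ℝ (Fin d)}
    (h : s ≤ ‖ξ‖ ^ 2) : ‖graphMap (sheetHeight s) ξ‖ ^ 2 = 2 * ‖ξ‖ ^ 2 - s := by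
  rw [WithLp.prod_norm_sq_eq_of_L2, graphMap_fst, graphMap_snd, sheetHeight, Real.norm_eq_abs,
    sq_abs, Real.sq_sqrt (sub_nonneg.2 h)]
  ring

theorem bounds_of_sheetIntegrand_ne_zero {d : ℕ} {G : SpaceTime d → ℂ} (hG : IsAnnularWeight G)
    {s : ℝ} {ξ : EuclideanSpace ℝ (Fin d)} (h : sheetIntegrand G s ξ ≠ 0) :
    s < ‖ξ‖ ^ 2 ∧ ‖ξ‖ ≤ 5 / 4 ∧ (1 / 16 - s) / 2 ≤ ‖ξ‖ ^ 2 - s := by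
  have h1 : s < ‖ξ‖ ^ 2 := by
    by_contra h2
    exact h (sheetIntegrand_of_le G (not_lt.1 h2))
  have h2 := hG.support_subset _ (right_ne_zero_of_mul h)
  have h3 := norm_graphMap_sheetHeight_sq h1.le
  refine ⟨h1, (WithLp.norm_fst_le _ (graphMap (sheetHeight s) ξ)).trans h2.2, ?_⟩
  nlinarith

theorem measurable_uncurry_sheetIntegrand {d : ℕ} {G : SpaceTime d → ℂ} (hG : Continuous G) :
    Measurable fun p : ℝ × EuclideanSpace ℝ (Fin d) => sheetIntegrand G p.1 p.2 := by
  have h1 : Continuous fun p : ℝ × EuclideanSpace ℝ (Fin d) => sheetHeight p.1 p.2 := by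
    unfold sheetHeight; fun_prop
  have h2 : Continuous fun p : ℝ × EuclideanSpace ℝ (Fin d) => graphMap (sheetHeight p.1) p.2 :=
    (WithLp.prod_continuous_toLp 2 _ _).comp (continuous_snd.prodMk h1)
  exact (Complex.measurable_ofReal.comp h1.measurable.inv).mul (hG.comp h2).measurable

theorem aestronglyMeasurable_sheetIntegrand {d : ℕ} {G : SpaceTime d → ℂ} (hG : Continuous G)
    (s : ℝ) : AEStronglyMeasurable (sheetIntegrand G s) :=
  ((measurable_uncurry_sheetIntegrand hG).comp measurable_prodMk_left).aestronglyMeasurable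

theorem continuousAt_sheetIntegrand {d : ℕ} {G : SpaceTime d → ℂ} (hG : Continuous G)
    {s₀ : ℝ} {ξ : EuclideanSpace ℝ (Fin d)} (h : ‖ξ‖ ^ 2 ≠ s₀) :
    ContinuousAt (fun s => sheetIntegrand G s ξ) s₀ := by
  rcases lt_or_gt_of_ne h with h1 | h1
  · refine ContinuousAt.congr (f := fun _ => 0) continuousAt_const ?_
    filter_upwards [lt_mem_nhds h1] with s hs
    exact (sheetIntegrand_of_le G hs.le).symm
  · have h2 : Continuous fun s : ℝ => sheetHeight s ξ := by unfold sheetHeight; fun_prop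
    have h3 : Continuous fun s : ℝ => graphMap (sheetHeight s) ξ :=
      (WithLp.prod_continuous_toLp 2 _ _).comp (continuous_const.prodMk h2)
    exact (Complex.continuous_ofReal.continuousAt.comp
      (h2.continuousAt.inv₀ (sheetHeight_pos h1).ne')).mul (hG.comp h3).continuousAt

/-- Away from the levels that meet the equator inside the annulus, the sheet integrand is bounded,
locally uniformly in the level. -/
theorem sheetIntegral_of_lt {d : ℕ} (hd : 1 ≤ d) {G : SpaceTime d → ℂ} (hG : IsAnnularWeight G)
    {s₀ : ℝ} (hs₀ : s₀ < 1 / 20) :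
    Integrable (sheetIntegrand G s₀) ∧
      ContinuousAt (fun s => ∫ ξ, sheetIntegrand G s ξ) s₀ := by
  have : Nonempty (Fin d) := ⟨⟨0, hd⟩⟩
  obtain ⟨B, hB, hGB⟩ := hG.exists_norm_le
  have hbound : ∀ s : ℝ, s < 1 / 20 → ∀ ξ : EuclideanSpace ℝ (Fin d),
      ‖sheetIntegrand G s ξ‖ ≤
        (Metric.closedBall (0 : EuclideanSpace ℝ (Fin d)) (5 / 4)).indicator
          (fun _ => (√(1 / 160))⁻¹ * B) ξ := by
    intro s hs ξ
    by_cases h0 : sheetIntegrand G s ξ = 0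
    · rw [h0, norm_zero]
      exact Set.indicator_nonneg (fun _ _ => by positivity) _
    · obtain ⟨h1, h2, h3⟩ := bounds_of_sheetIntegrand_ne_zero hG h0
      rw [Set.indicator_of_mem (mem_closedBall_zero_iff.2 h2), sheetIntegrand, norm_mul,
        Complex.norm_real, norm_inv, Real.norm_eq_abs, abs_of_pos (sheetHeight_pos h1)]
      gcongr
      · exact Real.sqrt_le_sqrt (by linarith)
      · exact hGB _
  have hint : Integrable ((Metric.closedBall (0 : EuclideanSpace ℝ (Fin d)) (5 / 4)).indicator
      (fun _ => (√(1 / 160))⁻¹ * B)) :=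
    (integrable_indicator_iff Metric.isClosed_closedBall.measurableSet).2
      (integrableOn_const (measure_closedBall_lt_top.ne))
  refine ⟨hint.mono' (aestronglyMeasurable_sheetIntegrand hG.continuous s₀)
    (Filter.Eventually.of_forall (hbound s₀ hs₀)), ?_⟩
  refine continuousAt_of_dominated (Filter.Eventually.of_forall fun s =>
    aestronglyMeasurable_sheetIntegrand hG.continuous s) ?_ hint ?_
  · filter_upwards [gt_mem_nhds hs₀] with s hs
    exact Filter.Eventually.of_forall (hbound s hs)
  · -- The integrand is discontinuous in `s` only for `ξ` on a sphere.
    have hnull := Measure.addHaar_sphere volume (0 : EuclideanSpace ℝ (Fin d)) (√s₀)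
    filter_upwards [measure_eq_zero_iff_ae_notMem.1 hnull] with ξ hξ
    refine continuousAt_sheetIntegrand hG.continuous fun h => hξ ?_
    rw [mem_sphere_zero_iff_norm, ← h, Real.sqrt_sq (norm_nonneg _)]

/-- The density of the hyperboloid `waveForm = 1` is integrable near its equator, where it is
singular. -/
theorem integrableOn_inv_sheetHeight_one {d : ℕ} (hd : 1 ≤ d) (R : ℝ) :
    IntegrableOn (fun ξ : EuclideanSpace ℝ (Fin d) => (sheetHeight 1 ξ)⁻¹)
      (Metric.ball 0 R) := by
  have : Nonempty (Fin d) := ⟨⟨0, hd⟩⟩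
  refine (integrableOn_fun_norm_addHaar volume (f := fun y : ℝ => (√(y ^ 2 - 1))⁻¹)).2 ?_
  -- In polar coordinates, `y ^ 2 - 1 ≥ y - 1` for the radius `y > 1`.
  have h1 : IntegrableOn (fun y : ℝ => |R| ^ (d - 1) * (y - 1) ^ (-(1 / 2) : ℝ))
      (Set.Ioc 1 (max R 1)) := by
    have h2 : IntervalIntegrable (fun y : ℝ => y ^ (-(1 / 2) : ℝ)) volume 0 (max R 1 - 1) :=
      intervalIntegral.intervalIntegrable_rpow' (by norm_num)
    have h3 := (h2.comp_sub_right 1).const_mul (|R| ^ (d - 1))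
    rw [zero_add, sub_add_cancel] at h3
    exact (intervalIntegrable_iff_integrableOn_Ioc_of_le (le_max_right _ _)).1 h3
  have h4 := (integrable_indicator_iff measurableSet_Ioc).2 h1
  refine h4.integrableOn.mono' (Measurable.aestronglyMeasurable (by fun_prop)) ?_
  filter_upwards [ae_restrict_mem measurableSet_Ioo] with y hy
  simp only [finrank_euclideanSpace_fin, smul_eq_mul]
  rcases le_or_gt y 1 with hy1 | hy1
  · rw [Real.sqrt_eq_zero_of_nonpos (by nlinarith [hy.1]), inv_zero, mul_zero, norm_zero]
    refine Set.indicator_nonneg (fun x hx => ?_) _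
    have : 0 ≤ x - 1 := by linarith [hx.1]
    positivity
  · have hmem : y ∈ Set.Ioc 1 (max R 1) := ⟨hy1, hy.2.le.trans (le_max_left _ _)⟩
    rw [Set.indicator_of_mem hmem, norm_mul, norm_pow, norm_inv, Real.norm_eq_abs, Real.norm_eq_abs,
      abs_of_nonneg (Real.sqrt_nonneg _), Real.rpow_neg (by linarith), ← Real.sqrt_eq_rpow]
    have h5 : 0 < y - 1 := by linarith
    have h6 : |y| ≤ |R| := by
      rw [abs_of_pos hy.1]
      exact hy.2.le.trans (le_abs_self R)
    have h7 : 0 < √(y - 1) := Real.sqrt_pos.2 h5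
    gcongr
    nlinarith

theorem sheetHeight_sqrt_smul {d : ℕ} {s : ℝ} (hs : 0 ≤ s) (ζ : EuclideanSpace ℝ (Fin d)) :
    sheetHeight s (√s • ζ) = √s * sheetHeight 1 ζ := by
  rw [sheetHeight, sheetHeight, ← Real.sqrt_mul hs, norm_smul, mul_pow, Real.norm_eq_abs, sq_abs,
    Real.sq_sqrt hs]
  congr 1
  ring

/-- At positive levels the hyperboloids are dilates of each other. After rescaling, the singular
factor no longer depends on the level. -/
theorem sheetIntegral_of_pos {d : ℕ} (hd : 1 ≤ d) {G : SpaceTime d → ℂ} (hG : IsAnnularWeight G)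
    {s₀ : ℝ} (hs₀ : 0 < s₀) :
    Integrable (sheetIntegrand G s₀) ∧
      ContinuousAt (fun s => ∫ ξ, sheetIntegrand G s ξ) s₀ := by
  obtain ⟨B, hB, hGB⟩ := hG.exists_norm_le
  set c := √(s₀ / 2) with hc
  have hc0 : 0 < c := Real.sqrt_pos.2 (by linarith)
  set R := 2 / c with hR
  have hbound : ∀ s : ℝ, s₀ / 2 < s → ∀ ζ : EuclideanSpace ℝ (Fin d),
      ‖sheetIntegrand G s (√s • ζ)‖ ≤ (Metric.ball (0 : EuclideanSpace ℝ (Fin d)) R).indicator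
        (fun ζ => c⁻¹ * B * (sheetHeight 1 ζ)⁻¹) ζ := by
    intro s hs ζ
    have hs0 : 0 < s := by linarith
    have hcs : c ≤ √s := Real.sqrt_le_sqrt hs.le
    by_cases h0 : sheetIntegrand G s (√s • ζ) = 0
    · rw [h0, norm_zero]
      exact Set.indicator_nonneg (fun ζ _ => mul_nonneg (by positivity)
        (inv_nonneg.2 (Real.sqrt_nonneg _))) _
    · obtain ⟨h1, h2, -⟩ := bounds_of_sheetIntegrand_ne_zero hG h0
      have hζ : ζ ∈ Metric.ball (0 : EuclideanSpace ℝ (Fin d)) R := by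
        rw [mem_ball_zero_iff, hR, lt_div_iff₀ hc0]
        rw [norm_smul, Real.norm_eq_abs, abs_of_nonneg (Real.sqrt_nonneg _)] at h2
        nlinarith [norm_nonneg ζ]
      have h3 : 0 ≤ sheetHeight 1 ζ := Real.sqrt_nonneg _
      rw [Set.indicator_of_mem hζ, sheetIntegrand, norm_mul,
        Complex.norm_real, norm_inv, Real.norm_eq_abs, sheetHeight_sqrt_smul hs0.le,
        abs_of_nonneg (by positivity), mul_inv]
      calc _ ≤ c⁻¹ * (sheetHeight 1 ζ)⁻¹ * B := by
            gcongr
            exact hGB _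
        _ = _ := by ring
  have hint : Integrable ((Metric.ball (0 : EuclideanSpace ℝ (Fin d)) R).indicator
      (fun ζ => c⁻¹ * B * (sheetHeight 1 ζ)⁻¹)) :=
    (integrable_indicator_iff Metric.isOpen_ball.measurableSet).2
      ((integrableOn_inv_sheetHeight_one hd R).const_mul _)
  have hmeas : ∀ s, AEStronglyMeasurable (fun ζ => sheetIntegrand G s (√s • ζ)) := fun s =>
    (((measurable_uncurry_sheetIntegrand hG.continuous).comp measurable_prodMk_left).comp
      (measurable_const_smul (√s))).aestronglyMeasurable
  constructor
  · have h1 : Integrable fun ζ => sheetIntegrand G s₀ (√s₀ • ζ) :=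
      hint.mono' (hmeas s₀) (Filter.Eventually.of_forall (hbound s₀ (by linarith)))
    exact (integrable_comp_smul_iff volume _ (Real.sqrt_pos.2 hs₀).ne').1 h1
  · have h1 : ContinuousAt (fun s => √s ^ d • ∫ ζ, sheetIntegrand G s (√s • ζ)) s₀ := by
      refine ContinuousAt.smul (Real.continuous_sqrt.pow d).continuousAt ?_
      refine continuousAt_of_dominated (Filter.Eventually.of_forall hmeas) ?_ hint ?_
      · filter_upwards [lt_mem_nhds (by linarith : s₀ / 2 < s₀)] with s hs
        exact Filter.Eventually.of_forall (hbound s hs)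
      · refine Filter.Eventually.of_forall fun ζ => ?_
        have h2 : ContinuousAt (fun s : ℝ => (((√s * sheetHeight 1 ζ)⁻¹ : ℝ) : ℂ) *
            G (WithLp.toLp 2 (√s • ζ, √s * sheetHeight 1 ζ))) s₀ := by
          refine ContinuousAt.mul ?_ ?_
          · simp_rw [mul_inv]
            have := (Real.continuous_sqrt.continuousAt (x := s₀)).inv₀ (Real.sqrt_pos.2 hs₀).ne'
            exact Complex.continuous_ofReal.continuousAt.comp (this.mul continuousAt_const)
          · refine (hG.continuous.comp ((WithLp.prod_continuous_toLp 2 _ _).comp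
              (Continuous.prodMk ?_ ?_))).continuousAt <;> fun_prop
        refine h2.congr ?_
        filter_upwards [lt_mem_nhds hs₀] with s hs
        simp only [sheetIntegrand, graphMap, sheetHeight_sqrt_smul hs.le]
    refine h1.congr ?_
    filter_upwards [lt_mem_nhds hs₀] with s hs
    have h3 : 0 < √s := Real.sqrt_pos.2 hs
    rw [Measure.integral_comp_smul, finrank_euclideanSpace_fin, abs_of_pos (by positivity),
      smul_smul, mul_inv_cancel₀ (by positivity), one_smul]

theorem sheetIntegral_regular {d : ℕ} (hd : 1 ≤ d) {G : SpaceTime d → ℂ} (hG : IsAnnularWeight G)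
    (s₀ : ℝ) :
    Integrable (sheetIntegrand G s₀) ∧
      ContinuousAt (fun s => ∫ ξ, sheetIntegrand G s ξ) s₀ := by
  rcases le_or_gt s₀ 0 with h | h
  · exact sheetIntegral_of_lt hd hG (by linarith)
  · exact sheetIntegral_of_pos hd hG h

/-- The substitution `s = ‖ξ‖² - τ²` on `τ > 0`, for fixed `ξ`. -/
theorem image_sub_sq_Ioi (a : ℝ) : (fun τ : ℝ => a - τ ^ 2) '' Set.Ioi 0 = Set.Iio a := by
  ext s
  constructor
  · rintro ⟨τ, hτ, rfl⟩
    have : 0 < τ ^ 2 := pow_pos hτ 2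
    simp only [Set.mem_Iio]
    linarith
  · intro hs
    have hs' : 0 < a - s := sub_pos.2 hs
    exact ⟨√(a - s), Real.sqrt_pos.2 hs', by simp [Real.sq_sqrt hs'.le]⟩

theorem hasDerivWithinAt_sub_sq (a τ : ℝ) (S : Set ℝ) :
    HasDerivWithinAt (fun τ : ℝ => a - τ ^ 2) (-(2 * τ)) S τ := by
  have := ((hasDerivAt_pow 2 τ).const_sub a).hasDerivWithinAt (s := S)
  simpa using this

theorem injOn_sub_sq (a : ℝ) : Set.InjOn (fun τ : ℝ => a - τ ^ 2) (Set.Ioi 0) := by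
  intro x hx y hy h
  have h1 : x ^ 2 = y ^ 2 := by simpa using h
  exact (sq_eq_sq₀ (le_of_lt hx) (le_of_lt hy)).1 h1

theorem two_mul_smul_sheetIntegrand {d : ℕ} (G : SpaceTime d → ℂ) (ξ : EuclideanSpace ℝ (Fin d))
    {τ : ℝ} (hτ : 0 < τ) : |-(2 * τ)| • sheetIntegrand G (‖ξ‖ ^ 2 - τ ^ 2) ξ =
      2 * G (WithLp.toLp 2 (ξ, τ)) := by
  have h1 : sheetHeight (‖ξ‖ ^ 2 - τ ^ 2) ξ = τ := by
    rw [sheetHeight, sub_sub_cancel, Real.sqrt_sq hτ.le]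
  have h2 : (τ : ℂ) ≠ 0 := by exact_mod_cast hτ.ne'
  rw [sheetIntegrand, graphMap, h1, abs_neg, abs_of_pos (by positivity), Complex.real_smul]
  push_cast
  field_simp

theorem sheetIntegrand_indicator {d : ℕ} (G : SpaceTime d → ℂ) (ξ : EuclideanSpace ℝ (Fin d)) :
    (Set.Iio (‖ξ‖ ^ 2)).indicator (fun s => sheetIntegrand G s ξ) =
      fun s => sheetIntegrand G s ξ := by
  refine Set.indicator_eq_self.2 fun s hs => ?_
  by_contra h
  exact hs (sheetIntegrand_of_le G (not_lt.1 h))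

theorem integral_sheetIntegrand_level {d : ℕ} (G : SpaceTime d → ℂ)
    (ξ : EuclideanSpace ℝ (Fin d)) :
    ∫ s, sheetIntegrand G s ξ = ∫ τ in Set.Ioi (0 : ℝ), 2 * G (WithLp.toLp 2 (ξ, τ)) := by
  rw [← sheetIntegrand_indicator, integral_indicator measurableSet_Iio, ← image_sub_sq_Ioi,
    integral_image_eq_integral_abs_deriv_smul measurableSet_Ioi
      (fun τ _ => hasDerivWithinAt_sub_sq _ τ _) (injOn_sub_sq _)]
  exact setIntegral_congr_fun measurableSet_Ioi fun τ hτ => two_mul_smul_sheetIntegrand G ξ hτ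

theorem integrable_sheetIntegrand_level_iff {d : ℕ} (G : SpaceTime d → ℂ)
    (ξ : EuclideanSpace ℝ (Fin d)) :
    Integrable (fun s => sheetIntegrand G s ξ) ↔
      IntegrableOn (fun τ => 2 * G (WithLp.toLp 2 (ξ, τ))) (Set.Ioi 0) := by
  rw [← sheetIntegrand_indicator, integrable_indicator_iff measurableSet_Iio, ← image_sub_sq_Ioi,
    integrableOn_image_iff_integrableOn_abs_deriv_smul measurableSet_Ioi
      (fun τ _ => hasDerivWithinAt_sub_sq _ τ _) (injOn_sub_sq _)]
  exact integrableOn_congr_fun (fun τ hτ => two_mul_smul_sheetIntegrand G ξ hτ) measurableSet_Ioi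

theorem IsAnnularWeight.integrable {d : ℕ} {G : SpaceTime d → ℂ} (hG : IsAnnularWeight G) :
    Integrable G :=
  hG.continuous.integrable_of_hasCompactSupport hG.hasCompactSupport

theorem IsAnnularWeight.integrable_prod {d : ℕ} {G : SpaceTime d → ℂ} (hG : IsAnnularWeight G) :
    Integrable (fun p : EuclideanSpace ℝ (Fin d) × ℝ => G (WithLp.toLp 2 p)) :=
  (WithLp.volume_preserving_toLp (EuclideanSpace ℝ (Fin d)) ℝ).integrable_comp_of_integrable
    hG.integrable

theorem IsAnnularWeight.integrable_slice {d : ℕ} {G : SpaceTime d → ℂ} (hG : IsAnnularWeight G)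
    (ξ : EuclideanSpace ℝ (Fin d)) : Integrable fun τ : ℝ => G (WithLp.toLp 2 (ξ, τ)) := by
  have h1 : Continuous fun τ : ℝ => G (WithLp.toLp 2 (ξ, τ)) :=
    hG.continuous.comp ((WithLp.prod_continuous_toLp 2 _ _).comp
      (continuous_const.prodMk continuous_id))
  refine h1.integrable_of_hasCompactSupport (HasCompactSupport.of_support_subset_isCompact
    (isCompact_closedBall (0 : ℝ) (5 / 4)) fun τ hτ => mem_closedBall_zero_iff.2 ?_)
  exact (WithLp.norm_snd_le _ (WithLp.toLp 2 (ξ, τ) : SpaceTime d)).trans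
    (hG.support_subset _ hτ).2

theorem integrable_uncurry_sheetIntegrand {d : ℕ} {G : SpaceTime d → ℂ} (hG : IsAnnularWeight G) :
    Integrable fun p : ℝ × EuclideanSpace ℝ (Fin d) => sheetIntegrand G p.1 p.2 := by
  have hmeas := (measurable_uncurry_sheetIntegrand hG.continuous).aestronglyMeasurable
    (μ := (volume : Measure (ℝ × EuclideanSpace ℝ (Fin d))))
  rw [Measure.volume_eq_prod] at hmeas ⊢
  refine (integrable_prod_iff' hmeas).2 ⟨Filter.Eventually.of_forall fun ξ => ?_, ?_⟩
  · exact (integrable_sheetIntegrand_level_iff G ξ).2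
      ((hG.integrable_slice ξ).const_mul 2).integrableOn
  · have h1 : ∀ ξ : EuclideanSpace ℝ (Fin d), ∫ s, ‖sheetIntegrand G s ξ‖ =
        ∫ τ in Set.Ioi (0 : ℝ), 2 * ‖G (WithLp.toLp 2 (ξ, τ))‖ := by
      intro ξ
      have hind : (Set.Iio (‖ξ‖ ^ 2)).indicator (fun s => ‖sheetIntegrand G s ξ‖) =
          fun s => ‖sheetIntegrand G s ξ‖ := by
        refine Set.indicator_eq_self.2 fun s hs => ?_
        by_contra h
        refine hs ?_
        simp [sheetIntegrand_of_le G (not_lt.1 h)]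
      rw [← hind, integral_indicator measurableSet_Iio, ← image_sub_sq_Ioi,
        integral_image_eq_integral_abs_deriv_smul measurableSet_Ioi
          (fun τ _ => hasDerivWithinAt_sub_sq _ τ _) (injOn_sub_sq _)]
      refine setIntegral_congr_fun measurableSet_Ioi fun τ hτ => ?_
      have h2 := congrArg norm (two_mul_smul_sheetIntegrand G ξ hτ)
      simpa [norm_smul] using h2
    simp_rw [h1]
    have h2 : Integrable (fun p : EuclideanSpace ℝ (Fin d) × ℝ => 2 * ‖G (WithLp.toLp 2 p)‖)
        (volume.prod (volume.restrict (Set.Ioi (0 : ℝ)))) := by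
      have := (hG.integrable_prod.norm.const_mul 2).integrableOn
        (s := Set.univ ×ˢ Set.Ioi (0 : ℝ))
      rwa [IntegrableOn, Measure.volume_eq_prod, ← Measure.prod_restrict,
        Measure.restrict_univ] at this
    exact h2.integral_prod_left

/-- The coarea identity, in Fourier form: the Fourier transform in the level `s` of the sheet
integral is the integral of the weight against `exp (-2πi l (‖ξ‖² - τ²))` over the half space. -/
theorem fourier_sheetIntegral {d : ℕ} {G : SpaceTime d → ℂ} (hG : IsAnnularWeight G) (l : ℝ) :
    𝓕 (fun s => ∫ ξ, sheetIntegrand G s ξ) l =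
      ∫ ξ : EuclideanSpace ℝ (Fin d), ∫ τ in Set.Ioi (0 : ℝ),
        2 * (Complex.exp (((-2 * Real.pi * ((‖ξ‖ ^ 2 - τ ^ 2) * l) : ℝ) : ℂ) * Complex.I) *
          G (WithLp.toLp 2 (ξ, τ))) := by
  set e : ℝ → ℂ := fun s => Complex.exp (((-2 * Real.pi * (s * l) : ℝ) : ℂ) * Complex.I) with he
  have hsheet : ∀ s (ξ : EuclideanSpace ℝ (Fin d)), e s * sheetIntegrand G s ξ =
      sheetIntegrand (fun z => e (‖z.fst‖ ^ 2 - z.snd ^ 2) * G z) s ξ := by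
    intro s ξ
    rcases le_or_gt (‖ξ‖ ^ 2) s with h | h
    · rw [sheetIntegrand_of_le _ h, sheetIntegrand_of_le _ h, mul_zero]
    · have : ‖ξ‖ ^ 2 - sheetHeight s ξ ^ 2 = s := by
        rw [sheetHeight, Real.sq_sqrt (sub_pos.2 h).le, sub_sub_cancel]
      simp only [sheetIntegrand, graphMap_fst, graphMap_snd, this]
      ring
  have hfst : Continuous fun z : SpaceTime d => z.fst := WithLp.continuous_fst ..
  have hsnd : Continuous fun z : SpaceTime d => z.snd := WithLp.continuous_snd ..
  have hGe : IsAnnularWeight fun z : SpaceTime d => e (‖z.fst‖ ^ 2 - z.snd ^ 2) * G z := by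
    refine ⟨?_, fun z hz => hG.support_subset z (right_ne_zero_of_mul hz)⟩
    have := hG.continuous
    fun_prop
  rw [Real.fourier_eq']
  calc _ = ∫ s, ∫ ξ, sheetIntegrand (fun z => e (‖z.fst‖ ^ 2 - z.snd ^ 2) * G z) s ξ := by
        refine integral_congr_ae (Filter.Eventually.of_forall fun s => ?_)
        simp_rw [← hsheet]
        rw [integral_const_mul, smul_eq_mul, real_inner_comm]
        rfl
    _ = ∫ ξ, ∫ s, sheetIntegrand (fun z => e (‖z.fst‖ ^ 2 - z.snd ^ 2) * G z) s ξ :=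
        integral_integral_swap (integrable_uncurry_sheetIntegrand hGe)
    _ = _ := by
        refine integral_congr_ae (Filter.Eventually.of_forall fun ξ => ?_)
        exact integral_sheetIntegrand_level _ ξ

/-! ### Fourier inversion in the level and the decay estimate -/

theorem contDiff_norm_mul {E : Type*} [NormedAddCommGroup E] [InnerProductSpace ℝ E] {η : E → ℝ}
    (hη : ContDiff ℝ (⊤ : ℕ∞) η) {r : ℝ} (hr : 0 < r) (hsupp : ∀ z, η z ≠ 0 → r ≤ ‖z‖) :
    ContDiff ℝ (⊤ : ℕ∞) fun z => ((2 * (‖z‖ * η z) : ℝ) : ℂ) := by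
  have h1 : ContDiff ℝ (⊤ : ℕ∞) fun z => ‖z‖ * η z := by
    refine contDiff_iff_contDiffAt.2 fun z => ?_
    rcases eq_or_ne z 0 with rfl | hz
    · refine contDiffAt_const (c := (0 : ℝ)) |>.congr_of_eventuallyEq ?_
      filter_upwards [Metric.ball_mem_nhds (0 : E) hr] with z hz
      have : η z = 0 := by
        by_contra h
        exact absurd (mem_ball_zero_iff.1 hz) (not_lt.2 (hsupp z h))
      rw [this, mul_zero]
    · exact (contDiffAt_norm ℝ hz).mul hη.contDiffAt
  exact Complex.ofRealCLM.contDiff.comp (contDiff_const.mul h1)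

/-- The integrand `exp (2πi ⟪z, y⟫) η(z)` of the inverse Fourier transform. -/
def fourierIntegrand {d : ℕ} (η : SpaceTime d → ℝ) (y z : SpaceTime d) : ℂ :=
  quadPhase (timeReflection d) 0 y z * η z

theorem invFourierLocalized_eq {d : ℕ} (η : SpaceTime d → ℝ) (s : ℝ)
    (x : EuclideanSpace ℝ (Fin d)) (t : ℝ) :
    invFourierLocalized η s x t =
      ∫ z, fourierIntegrand η (WithLp.toLp 2 (x, t)) z ∂(surfaceMeasure d s) := by
  refine integral_congr_ae (Filter.Eventually.of_forall fun z => ?_)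
  simp only [fourierIntegrand, quadPhase, inner_spaceTime]
  congr 2
  have : inner ℝ z.snd t = z.snd * t := mul_comm _ _
  change _ = ((2 * Real.pi * (inner ℝ z.fst x + inner ℝ z.snd t - _) : ℝ) : ℂ) * _
  rw [this]
  push_cast
  ring

theorem IsAnnularBump.annulus {d : ℕ} {η : SpaceTime d → ℝ} (hη : IsAnnularBump η)
    (z : SpaceTime d) (hz : η z ≠ 0) : 1 / 4 ≤ ‖z‖ ∧ ‖z‖ ≤ 5 / 4 := hη.support_subset hz

theorem continuous_fourierIntegrand {d : ℕ} {η : SpaceTime d → ℝ} (hη : IsAnnularBump η)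
    (y : SpaceTime d) : Continuous (fourierIntegrand η y) :=
  (continuous_quadPhase _ _ _).mul (Complex.continuous_ofReal.comp hη.smooth.continuous)

theorem isAnnularWeight_fourierIntegrand {d : ℕ} {η : SpaceTime d → ℝ} (hη : IsAnnularBump η)
    (y : SpaceTime d) : IsAnnularWeight fun z => ‖z‖ * fourierIntegrand η y z where
  continuous := (Complex.continuous_ofReal.comp continuous_norm).mul
    (continuous_fourierIntegrand hη y)
  support_subset z hz := hη.annulus z
    (by exact_mod_cast right_ne_zero_of_mul (right_ne_zero_of_mul hz))

theorem continuous_timeReflection (d : ℕ) : Continuous (timeReflection d) :=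
  AddMonoidHomClass.continuous_of_bound (timeReflection d) 1 fun z => by
    rw [norm_timeReflection, one_mul]

theorem isAnnularWeight_fourierIntegrand_reflected {d : ℕ} {η : SpaceTime d → ℝ}
    (hη : IsAnnularBump η) (y : SpaceTime d) :
    IsAnnularWeight fun z => ‖z‖ * fourierIntegrand η y (timeReflection d z) where
  continuous := (Complex.continuous_ofReal.comp continuous_norm).mul
    ((continuous_fourierIntegrand hη y).comp (continuous_timeReflection d))
  support_subset z hz := by
    rw [← norm_timeReflection]
    exact hη.annulus _ (by exact_mod_cast right_ne_zero_of_mul (right_ne_zero_of_mul hz))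

theorem isAnnularWeight_symmetrized {d : ℕ} {η : SpaceTime d → ℝ}
    (hη : IsAnnularBump η) (y : SpaceTime d) :
    IsAnnularWeight fun z =>
      ‖z‖ * (fourierIntegrand η y z + fourierIntegrand η y (timeReflection d z)) where
  continuous := (Complex.continuous_ofReal.comp continuous_norm).mul
    ((continuous_fourierIntegrand hη y).add
      ((continuous_fourierIntegrand hη y).comp (continuous_timeReflection d)))
  support_subset z hz := by
    have h := right_ne_zero_of_mul hz
    by_cases h1 : fourierIntegrand η y z = 0
    · rw [h1, zero_add] at h
      rw [← norm_timeReflection]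
      exact hη.annulus _ (by exact_mod_cast right_ne_zero_of_mul h)
    · exact hη.annulus _ (by exact_mod_cast right_ne_zero_of_mul h1)

theorem integral_eq_integral_Ioi_add_comp_neg {f : ℝ → ℂ} (hf : Integrable f) :
    ∫ τ, f τ = ∫ τ in Set.Ioi (0 : ℝ), (f τ + f (-τ)) := by
  rw [integral_add hf.integrableOn hf.comp_neg.integrableOn, integral_comp_neg_Ioi, neg_zero,
    add_comm, intervalIntegral.integral_Iic_add_Ioi hf.integrableOn hf.integrableOn]

/-- The Fourier transform of the surface integral with respect to the level is an oscillatory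
integral over the whole space, with quadratic phase. -/
theorem fourier_sheetIntegral_fourierIntegrand {d : ℕ} {η : SpaceTime d → ℝ}
    (hη : IsAnnularBump η) (y : SpaceTime d) (l : ℝ) :
    𝓕 (fun s => ∫ ξ, sheetIntegrand (fun z => ‖z‖ * (fourierIntegrand η y z +
      fourierIntegrand η y (timeReflection d z))) s ξ) l =
      quadOscInt (timeReflection d) (fun z => ((2 * (‖z‖ * η z) : ℝ) : ℂ)) l y := by
  rw [fourier_sheetIntegral (isAnnularWeight_symmetrized hη y)]
  set h : SpaceTime d → ℂ := fun z => ((2 * (‖z‖ * η z) : ℝ) : ℂ) with hh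
  have hweight : IsAnnularWeight fun z => quadPhase (timeReflection d) l y z * h z := by
    refine ⟨(continuous_quadPhase _ _ _).mul (Complex.continuous_ofReal.comp
      (continuous_const.mul (continuous_norm.mul hη.smooth.continuous))), fun z hz => ?_⟩
    have h1 : 2 * (‖z‖ * η z) ≠ 0 := Complex.ofReal_ne_zero.1 (right_ne_zero_of_mul hz)
    exact hη.annulus z (right_ne_zero_of_mul (right_ne_zero_of_mul h1))
  -- On each slice, the two signs of `τ` combine to the integral over the line.
  have hslice : ∀ z : SpaceTime d,
      2 * (Complex.exp (((-2 * Real.pi * ((‖z.fst‖ ^ 2 - z.snd ^ 2) * l) : ℝ) : ℂ) * Complex.I) *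
        (‖z‖ * fourierIntegrand η y z)) = quadPhase (timeReflection d) l y z * h z := by
    intro z
    have h1 : quadPhase (timeReflection d) l y z =
        Complex.exp (((-2 * Real.pi * ((‖z.fst‖ ^ 2 - z.snd ^ 2) * l) : ℝ) : ℂ) * Complex.I) *
          quadPhase (timeReflection d) 0 y z := by
      rw [quadPhase, quadPhase, ← Complex.exp_add, ← waveForm_eq_inner, waveForm]
      congr 1
      push_cast
      ring
    rw [h1, hh, fourierIntegrand]
    push_cast
    ring
  calc _ = ∫ ξ : EuclideanSpace ℝ (Fin d), ∫ τ : ℝ, quadPhase (timeReflection d) l y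
        (WithLp.toLp 2 (ξ, τ)) * h (WithLp.toLp 2 (ξ, τ)) := by
        refine integral_congr_ae (Filter.Eventually.of_forall fun ξ => ?_)
        simp only
        rw [integral_eq_integral_Ioi_add_comp_neg (hweight.integrable_slice ξ)]
        refine setIntegral_congr_fun measurableSet_Ioi fun τ _ => ?_
        have h3 : ‖(WithLp.toLp 2 (ξ, -τ) : SpaceTime d)‖ =
            ‖(WithLp.toLp 2 (ξ, τ) : SpaceTime d)‖ :=
          norm_timeReflection (WithLp.toLp 2 (ξ, τ) : SpaceTime d)
        have h4 : timeReflection d (WithLp.toLp 2 (ξ, τ)) = WithLp.toLp 2 (ξ, -τ) := rfl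
        have h1 : 2 * (Complex.exp (((-2 * Real.pi * ((‖ξ‖ ^ 2 - τ ^ 2) * l) : ℝ) : ℂ) *
            Complex.I) * (‖(WithLp.toLp 2 (ξ, τ) : SpaceTime d)‖ *
              fourierIntegrand η y (WithLp.toLp 2 (ξ, τ)))) = _ := hslice (WithLp.toLp 2 (ξ, τ))
        have h2 : 2 * (Complex.exp (((-2 * Real.pi * ((‖ξ‖ ^ 2 - (-τ) ^ 2) * l) : ℝ) : ℂ) *
            Complex.I) * (‖(WithLp.toLp 2 (ξ, -τ) : SpaceTime d)‖ *
              fourierIntegrand η y (WithLp.toLp 2 (ξ, -τ)))) = _ :=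
          hslice (WithLp.toLp 2 (ξ, -τ))
        rw [neg_sq, h3] at h2
        simp only [h4, ← h1, ← h2]
        ring
    _ = _ := by
        rw [quadOscInt, ← integral_prod (fun p : EuclideanSpace ℝ (Fin d) × ℝ =>
          quadPhase (timeReflection d) l y (WithLp.toLp 2 p) * h (WithLp.toLp 2 p))
          hweight.integrable_prod, ← Measure.volume_eq_prod, ← integral_spaceTime]
        rfl

theorem norm_le_integral_norm_fourier {f : ℝ → ℂ} (hf : Integrable f) (hf' : Integrable (𝓕 f))
    {s : ℝ} (hs : ContinuousAt f s) : ‖f s‖ ≤ ∫ l, ‖𝓕 f l‖ := by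
  rw [← hf.fourierInv_fourier_eq hf' hs, Real.fourierInv_eq']
  refine (norm_integral_le_integral_norm _).trans (le_of_eq ?_)
  refine integral_congr_ae (Filter.Eventually.of_forall fun l => ?_)
  simp only [norm_smul, Complex.norm_exp_ofReal_mul_I, one_mul]

theorem integrable_and_integral_fourierIntegrand {d : ℕ} (hd : 1 ≤ d) {η : SpaceTime d → ℝ}
    (hη : IsAnnularBump η) (y : SpaceTime d) (s : ℝ) :
    Integrable (fourierIntegrand η y) (surfaceMeasure d s) ∧
      ∫ z, fourierIntegrand η y z ∂(surfaceMeasure d s) =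
      ∫ ξ, sheetIntegrand (fun z => ‖z‖ * (fourierIntegrand η y z +
        fourierIntegrand η y (timeReflection d z))) s ξ :=
  integral_surfaceMeasure s (continuous_fourierIntegrand hη y)
    (sheetIntegral_regular hd (isAnnularWeight_fourierIntegrand hη y) s).1
    (sheetIntegral_regular hd (isAnnularWeight_fourierIntegrand_reflected hη y) s).1

theorem integrable_surfaceMeasure {d : ℕ} (hd : 1 ≤ d) {η : SpaceTime d → ℝ}
    (hη : IsAnnularBump η) (s : ℝ) : Integrable η (surfaceMeasure d s) := by
  refine (integrable_and_integral_fourierIntegrand hd hη 0 s).1.re.congr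
    (Filter.Eventually.of_forall fun z => ?_)
  simp [fourierIntegrand, quadPhase]

theorem exists_norm_invFourierLocalized_le {d : ℕ} (hd : 1 ≤ d) {η : SpaceTime d → ℝ}
    (hη : IsAnnularBump η) : ∃ C : ℝ, 0 ≤ C ∧ ∀ (s : ℝ) (x : EuclideanSpace ℝ (Fin d)) (t : ℝ),
      ‖invFourierLocalized η s x t‖ ≤ C * (1 + |t|) ^ ((2 - ((d : ℝ) + 1)) / 2) := by
  have hsupp : ∀ z : SpaceTime d, ((2 * (‖z‖ * η z) : ℝ) : ℂ) ≠ 0 →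
      1 / 4 ≤ ‖z‖ ∧ ‖z‖ ≤ 5 / 4 := fun z hz => by
    have h1 : 2 * (‖z‖ * η z) ≠ 0 := by exact_mod_cast hz
    exact hη.annulus z (right_ne_zero_of_mul (right_ne_zero_of_mul h1))
  have hcs : HasCompactSupport fun z : SpaceTime d => ((2 * (‖z‖ * η z) : ℝ) : ℂ) :=
    HasCompactSupport.of_support_subset_isCompact
      (isCompact_closedBall (0 : SpaceTime d) (5 / 4))
      fun z hz => mem_closedBall_zero_iff.2 (hsupp z hz).2
  set h := hcs.toSchwartzMap (contDiff_norm_mul hη.smooth (by norm_num : (0 : ℝ) < 1 / 4)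
    fun z hz => (hη.annulus z hz).1) with hh
  have hclosed : IsClosed {z : SpaceTime d | 1 / 4 ≤ ‖z‖ ∧ ‖z‖ ≤ 5 / 4} :=
    (isClosed_le continuous_const continuous_norm).inter
      (isClosed_le continuous_norm continuous_const)
  obtain ⟨C, hC, hb⟩ := exists_integral_norm_quadOscInt_timeReflection_le hd h
    (closure_minimal (fun z hz => hsupp z hz) hclosed)
  refine ⟨C, hC, fun s x t => ?_⟩
  set y : SpaceTime d := WithLp.toLp 2 (x, t) with hy
  have hF := fourier_sheetIntegral_fourierIntegrand hη y
  obtain ⟨hint, hle⟩ := hb y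
  have hweight := isAnnularWeight_symmetrized hη y
  rw [invFourierLocalized_eq, (integrable_and_integral_fourierIntegrand hd hη y s).2]
  have hFeq : 𝓕 (fun s => ∫ ξ, sheetIntegrand (fun z => ‖z‖ * (fourierIntegrand η y z +
      fourierIntegrand η y (timeReflection d z))) s ξ) =
      fun l => quadOscInt (timeReflection d) h l y := funext hF
  refine (norm_le_integral_norm_fourier
    (f := fun s => ∫ ξ, sheetIntegrand (fun z => ‖z‖ * (fourierIntegrand η y z +
      fourierIntegrand η y (timeReflection d z))) s ξ)
    (integrable_uncurry_sheetIntegrand hweight).integral_prod_left (by rw [hFeq]; exact hint)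
    (sheetIntegral_regular hd hweight s).2).trans ?_
  rw [hFeq]
  refine hle.trans ?_
  have ht : |t| ≤ ‖y‖ := WithLp.norm_snd_le _ y
  have hd' : (1 : ℝ) ≤ d := by exact_mod_cast hd
  exact mul_le_mul_of_nonneg_left (Real.rpow_le_rpow_of_nonpos (by positivity) (by linarith)
    (by linarith)) hC

/-! ### One-dimensional space-time -/

/-- For `d = 0` the hypersurface consists of at most two points. -/
theorem surfaceMeasure_zero_univ_le (s : ℝ) : surfaceMeasure 0 s Set.univ ≤ 2 := by
  rw [surfaceMeasure, Measure.restrict_apply_univ]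
  have hsub : levelSurface 0 s ⊆
      {WithLp.toLp 2 (0, √(-s))} ∪ {WithLp.toLp 2 (0, -√(-s))} := by
    rintro z ⟨hz, -⟩
    have h0 : z.fst = 0 := Subsingleton.elim _ _
    have h1 : z.snd ^ 2 = -s := by
      rw [waveForm, h0, norm_zero] at hz
      linarith
    have h2 : z.snd ^ 2 = √(-s) ^ 2 := by rw [Real.sq_sqrt (by rw [← h1]; positivity), h1]
    rcases sq_eq_sq_iff_eq_or_eq_neg.1 h2 with h | h
    · left
      apply WithLp.ofLp_injective 2
      exact Prod.ext h0 h
    · right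
      apply WithLp.ofLp_injective 2
      exact Prod.ext h0 h
  refine (measure_mono hsub).trans ((measure_union_le _ _).trans ?_)
  rw [Measure.euclideanHausdorffMeasure_zero, Measure.hausdorffMeasure_zero_singleton,
    Measure.hausdorffMeasure_zero_singleton, one_add_one_eq_two]

theorem integrable_and_bound_of_dim_zero {η : SpaceTime 0 → ℝ} (hη : IsAnnularBump η) :
    (∀ s, Integrable η (surfaceMeasure 0 s)) ∧ ∃ C : ℝ, 0 ≤ C ∧
      ∀ (s : ℝ) (x : EuclideanSpace ℝ (Fin 0)) (t : ℝ), ‖invFourierLocalized η s x t‖ ≤ C := by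
  have hcs : HasCompactSupport η := HasCompactSupport.of_support_subset_isCompact
    (isCompact_closedBall (0 : SpaceTime 0) (5 / 4))
    fun z hz => mem_closedBall_zero_iff.2 (hη.annulus z hz).2
  obtain ⟨B, hB⟩ := hcs.exists_bound_of_continuous hη.smooth.continuous
  have hB0 : 0 ≤ B := (norm_nonneg _).trans (hB 0)
  have hfin : ∀ s, IsFiniteMeasure (surfaceMeasure 0 s) := fun s =>
    ⟨(surfaceMeasure_zero_univ_le s).trans_lt (by simp)⟩
  refine ⟨fun s => ?_, B * 2, by positivity, fun s x t => ?_⟩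
  · have := hfin s
    exact Integrable.of_bound hη.smooth.continuous.aestronglyMeasurable B
      (Filter.Eventually.of_forall hB)
  · have := hfin s
    rw [invFourierLocalized_eq]
    refine (norm_integral_le_of_norm_le_const (C := B)
      (Filter.Eventually.of_forall fun z => ?_)).trans ?_
    · rw [fourierIntegrand, norm_mul, norm_quadPhase, one_mul, Complex.norm_real]
      exact hB z
    · gcongr
      exact ENNReal.toReal_le_of_le_ofReal (by norm_num)
        ((surfaceMeasure_zero_univ_le s).trans (by simp))

end

theorem lemma1 (d : ℕ) (η : SpaceTime d → ℝ) (hη : IsAnnularBump η) :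
    (∀ s ∈ Set.Ioo (-(1 / 10) : ℝ) (1 / 10), MeasureTheory.Integrable η (surfaceMeasure d s)) ∧
    ∃ C : ℝ, 0 < C ∧ ∀ s ∈ Set.Ioo (-(1 / 10) : ℝ) (1 / 10),
      ∀ (x : EuclideanSpace ℝ (Fin d)) (t : ℝ),
        ‖invFourierLocalized η s x t‖ ≤ C * (1 + |t|) ^ ((2 - ((d : ℝ) + 1)) / 2) := by
  rcases Nat.eq_zero_or_pos d with rfl | hd
  · obtain ⟨hint, C, hC, hb⟩ := integrable_and_bound_of_dim_zero hη
    refine ⟨fun s _ => hint s, C + 1, by positivity, fun s _ x t => (hb s x t).trans ?_⟩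
    have h1 : (1 : ℝ) ≤ (1 + |t|) ^ ((2 - (((0 : ℕ) : ℝ) + 1)) / 2) :=
      Real.one_le_rpow (by linarith [abs_nonneg t]) (by norm_num)
    nlinarith
  · obtain ⟨C, hC, hb⟩ := exists_norm_invFourierLocalized_le hd hη
    refine ⟨fun s _ => integrable_surfaceMeasure hd hη s, C + 1, by positivity,
      fun s _ x t => (hb s x t).trans ?_⟩
    gcongr
    linarith
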